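/- **Setting.** Let $(\Omega,\mathcal A,\mu)$ be a probability space and $T:\Omega\to\Omega$ a measurable map for which $\mu$ is invariant and mixing, i.e. $\mu(A\cap T^{-n}B)\to\mu(A)\mu(B)$ for all $A,B\in\mathcal A$. Let $\widehat T:\mathcal L^1\to\mathcal L^1$ be its transfer operator, i.e. the operator determined by $\int \widehat Tf\cdot g\,d\mu=\int f\cdot (g\circ T)\,d\mu$ for all $f\in\mathcal L^1$, $g\in\mathcal L^\infty$. Let $\mathcal F$ be a complex Banach algebra, with respect to a norm $\|\cdot\|$, of (classes modulo $\mu$-a.e. equality of) complex-valued measurable functions on $\Omega$ with pointwise multiplication. The system $(\Omega,\mathcal A,T,\mu,\mathcal F,\|\cdot\|)$ has *Property $\mathfrak C$* if, in addition, $\mathcal F$ contains the constants; $|f|_\infty\le\|f\|$ for all $f\in\mathcal F$; $\widehat T$ maps $\mathcal F$ to $\mathcal F$ and is bounded with respect to $\|\cdot\|$; and $\widehat T$ has a spectral gap on $\mathcal F$, i.e. $\widehat T|_{\mathcal F}=\lambda P+N$ with $\lambda\in\mathbb C$ and bounded linear operators $P,N$ on $\mathcal F$ such that $P^2=P$, $\dim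 \operatorname{Im}P=1$, $PN=NP=0$, and the spectral radius of $N$ is smaller than $|\lambda|$. Let $\chi:\Omega\to\mathbb R_{\ge0}$ be measurable. The system $(\Omega,\mathcal A,T,\mu,\mathcal F,\|\cdot\|,\chi)$ has *Property $\mathfrak D$* if it has Property $\mathfrak C$ and there are constants $K_1,K_2>0$ such that for all $\ell>0$ the functions $\chi\cdot\mathbb 1_{\{\chi\le\ell\}}$ and $\mathbb 1_{\{\chi>\ell\}}$ belong to $\mathcal F$, with $$\|\chi\cdot\mathbb 1_{\{\chi\le\ell\}}\|\le K_1\ell,\qquad \|\mathbb 1_{\{\chi>\ell\}}\|\le K_2 .$$ Let $F(x)=\mu(\chi\le x)$ be the distribution function of $\chi$. For $n,b\in\mathbb N_0$ let $\mathsf S_n^{b}\chi=\sum_{k=b}^{n-1}\chi\circ T^{\sigma(k)}$, where $\sigma$ is a (pointwise chosen) permutation of $\{0,\dots,n-1\}$ with $\chi\circ T^{\sigma(0)}\ge\dots\ge\chi\circ T^{\sigma(n-1)}$. For real $x$ let $\lceil x\rceil$ be the least non-negative integer $\ge x$. **Theorem 1.2.** Let $(\Omega,\mathcal A,T,\mu,\mathcal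 F,\|\cdot\|,\chi)$ have Property $\mathfrak D$. Then there is a constant $W>0$ such that the following holds for every $0<\epsilon<1/4$ and every sequence $(f_n)$ of positive reals with $f_n\to\infty$ (so $W$ depends neither on $\epsilon$ nor on $(f_n)$). Set $$a_n=n\,(1-F(f_n)),\qquad d_n=n\int_0^{f_n}x\,dF(x),$$ and suppose that $d_n>0$ for all sufficiently large $n$ (equivalently, $\chi$ is not $\mu$-a.e. zero) and that $$\lim_{n\to\infty}\frac{f_n}{d_n}\cdot\max\left\{a_n^{1/2+\epsilon}(\log\log n)^{1/2-\epsilon},\ \log n\right\}=0 .$$ Then, with $$b_n=\left\lceil a_n+W\cdot\max\left\{a_n^{1/2+\epsilon}(\log\log n)^{1/2-\epsilon},\ \log\log n\right\}\right\rceil ,$$ where for $n\le 2$ any real values may be used for the undefined expressions, we have $$\lim_{n\to\infty}\frac{\mathsf S_n^{b_n}\chi}{d_n}=1\qquad \mu\text{-a.s.}$$ -/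

import Mathlib

open MeasureTheory ProbabilityTheory Filter Topology
open scoped ENNReal NNReal

/-- `μ` is (strongly) mixing under `T`:
`μ (A ∩ T⁻ⁿ B) → μ A * μ B` for all measurable sets `A`, `B`. -/
def IsMixing {Ω : Type*} [MeasurableSpace Ω] (T : Ω → Ω) (μ : Measure Ω) : Prop :=
  ∀ A B : Set Ω, MeasurableSet A → MeasurableSet B →
    Tendsto (fun n : ℕ => μ (A ∩ T^[n] ⁻¹' B)) atTop (𝓝 (μ A * μ B))

/-- `That` is the transfer operator of `T` on `L¹(μ)`, i.e. the (unique) operator with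
`∫ (That f) * g dμ = ∫ f * (g ∘ T) dμ` for all `f ∈ L¹` and `g ∈ L^∞`. -/
def IsTransferOperator {Ω : Type*} [MeasurableSpace Ω] (T : Ω → Ω) (μ : Measure Ω)
    (That : Lp ℂ 1 μ →L[ℂ] Lp ℂ 1 μ) : Prop :=
  ∀ (f : Lp ℂ 1 μ) (g : Ω → ℂ), MemLp g ∞ μ →
    ∫ x, That f x * g x ∂μ = ∫ x, f x * g (T x) ∂μ

/-- A bounded operator `U` on a complex Banach space has a spectral gap: `U = z P + N` with a
projection `P` of rank one, `P N = N P = 0` and spectral radius of `N` smaller than `|z|`. -/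
def HasSpectralGap {F : Type*} [NormedAddCommGroup F] [NormedSpace ℂ F]
    (U : F →L[ℂ] F) : Prop :=
  ∃ (z : ℂ) (P N : F →L[ℂ] F),
    U = z • P + N ∧
    P ∘L P = P ∧ Module.finrank ℂ (LinearMap.range (P : F →ₗ[ℂ] F)) = 1 ∧
    spectralRadius ℂ N < ‖z‖₊ ∧
    P ∘L N = 0 ∧ N ∘L P = 0

/-- The injective linear map `ι` realizes the Banach algebra `F` (with its own norm) as an algebra
of (almost everywhere classes of) measurable complex functions, with pointwise product, which
contains the constants (as `ι 1 = 1`), and whose norm dominates the essential supremum. -/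
structure IsFunctionAlgebra {Ω : Type*} [MeasurableSpace Ω] (μ : Measure Ω)
    {F : Type*} [NormedCommRing F] [NormedAlgebra ℂ F]
    (ι : F →ₗ[ℂ] (Ω →ₘ[μ] ℂ)) : Prop where
  injective : Function.Injective ι
  map_one : ι 1 = 1
  map_mul : ∀ h k : F, ι (h * k) = ι h * ι k
  ae_norm_le : ∀ h : F, ∀ᵐ x ∂μ, ‖ι h x‖ ≤ ‖h‖

/-- The inclusion of `F` in `L¹(μ)`; it exists as the elements of `F` are essentially bounded. -/
noncomputable def IsFunctionAlgebra.toL1 {Ω : Type*} [MeasurableSpace Ω] {μ : Measure Ω} [IsFiniteMeasure μ]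
    {F : Type*} [NormedCommRing F] [NormedAlgebra ℂ F]
    {ι : F →ₗ[ℂ] (Ω →ₘ[μ] ℂ)} (hι : IsFunctionAlgebra μ ι) (h : F) : Lp ℂ 1 μ :=
  ⟨ι h, Lp.mem_Lp_iff_memLp.2
    (MemLp.of_bound (ι h).aestronglyMeasurable ‖h‖ (hι.ae_norm_le h))⟩

/-- Property C of `(Ω, T, μ, F, ‖·‖)`, where `F` is included in the measurable functions by `ι`. -/
structure PropertyC {Ω : Type*} [MeasurableSpace Ω] (T : Ω → Ω) (μ : Measure Ω)
    [IsProbabilityMeasure μ] {F : Type*} [NormedCommRing F] [NormedAlgebra ℂ F] [CompleteSpace F]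
    (ι : F →ₗ[ℂ] (Ω →ₘ[μ] ℂ)) : Prop where
  /-- `μ` is `T`-invariant -/
  measurePreserving : MeasurePreserving T μ μ
  mixing : IsMixing T μ
  isFunctionAlgebra : IsFunctionAlgebra μ ι
  /-- the transfer operator restricts to a bounded operator `U` of `F`, with a spectral gap -/
  transfer : ∃ That : Lp ℂ 1 μ →L[ℂ] Lp ℂ 1 μ, IsTransferOperator T μ That ∧
    ∃ U : F →L[ℂ] F,
      (∀ h : F, That (isFunctionAlgebra.toL1 h) = isFunctionAlgebra.toL1 (U h)) ∧
      HasSpectralGap U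

/-- The truncation `χ * 1_{χ ≤ ℓ}`. -/
noncomputable def truncate {Ω : Type*} (χ : Ω → ℝ) (ℓ : ℝ) : Ω → ℝ :=
  {x | χ x ≤ ℓ}.indicator χ

/-- Property D of `(Ω, T, μ, F, ‖·‖, χ)`. The observable `χ` may be unbounded; its truncations
`χ * 1_{χ ≤ ℓ}` and the indicators `1_{χ > ℓ}` are in `F`, with the stated bounds of their norms. -/
structure PropertyD {Ω : Type*} [MeasurableSpace Ω] (T : Ω → Ω) (μ : Measure Ω)
    [IsProbabilityMeasure μ] {F : Type*} [NormedCommRing F] [NormedAlgebra ℂ F] [CompleteSpace F]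
    (ι : F →ₗ[ℂ] (Ω →ₘ[μ] ℂ)) (χ : Ω → ℝ) : Prop where
  propertyC : PropertyC T μ ι
  measurable : Measurable χ
  nonneg : ∀ x, 0 ≤ χ x
  norm_truncate_le : ∃ K₁ : ℝ, 0 < K₁ ∧ ∀ ℓ : ℝ, 0 < ℓ →
    ∃ h : F, (∀ᵐ x ∂μ, ι h x = (truncate χ ℓ x : ℂ)) ∧ ‖h‖ ≤ K₁ * ℓ
  norm_indicator_le : ∃ K₂ : ℝ, 0 < K₂ ∧ ∀ ℓ : ℝ, 0 < ℓ →
    ∃ h : F, (∀ᵐ x ∂μ, ι h x = {y | ℓ < χ y}.indicator (fun _ => (1 : ℂ)) x) ∧ ‖h‖ ≤ K₂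

/-- A permutation `σ` of `{0, …, n-1}` with
`χ (T^{σ 0} x) ≥ χ (T^{σ 1} x) ≥ … ≥ χ (T^{σ (n-1)} x)`. -/
noncomputable def orderPerm {Ω : Type*} (T : Ω → Ω) (χ : Ω → ℝ) (n : ℕ) (x : Ω) :
    Equiv.Perm (Fin n) :=
  Tuple.sort (fun i : Fin n => -χ (T^[i] x))

/-- The trimmed Birkhoff sum `∑_{k=b}^{n-1} χ ∘ T^{σ k}`, i.e. the sum of the first `n` terms
`χ, χ ∘ T, …, χ ∘ T^{n-1}` without the `b` largest ones (it is `0` if `b ≥ n`). -/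
noncomputable def trimmedSum {Ω : Type*} (T : Ω → Ω) (χ : Ω → ℝ) (n b : ℕ) (x : Ω) : ℝ :=
  ∑ k ∈ Finset.univ.filter (fun k : Fin n => b ≤ (k : ℕ)), χ (T^[orderPerm T χ n x k] x)

theorem antitone_orderPerm {Ω : Type*} (T : Ω → Ω) (χ : Ω → ℝ) (n : ℕ) (x : Ω) :
    Antitone (fun k : Fin n => χ (T^[orderPerm T χ n x k] x)) := by
  intro i j hij
  have := Tuple.monotone_sort (fun i : Fin n => -χ (T^[i] x)) hij
  simp only [Function.comp_apply, neg_le_neg_iff] at this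
  exact this

/-- The trimmed sum does not depend on the choice of the ordering permutation. -/
theorem trimmedSum_eq {Ω : Type*} (T : Ω → Ω) (χ : Ω → ℝ) (n b : ℕ) (x : Ω)
    (σ : Equiv.Perm (Fin n)) (hσ : Antitone (fun k : Fin n => χ (T^[σ k] x))) :
    trimmedSum T χ n b x = ∑ k ∈ Finset.univ.filter (fun k : Fin n => b ≤ (k : ℕ)), χ (T^[σ k] x) := by
  have h := Tuple.unique_monotone (f := fun i : Fin n => -χ (T^[i] x))
    (σ := orderPerm T χ n x) (τ := σ)
    (fun i j hij => neg_le_neg (antitone_orderPerm T χ n x hij))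
    (fun i j hij => neg_le_neg (hσ hij))
  refine Finset.sum_congr rfl fun k _ => ?_
  simpa using congrFun h k

/-- The distribution function `F x = μ (χ ≤ x)` of `χ`. -/
noncomputable def distFun {Ω : Type*} [MeasurableSpace Ω] (μ : Measure Ω) (χ : Ω → ℝ) :
    StieltjesFunction ℝ :=
  cdf (μ.map χ)

/-- `a_n = n (1 - F (f_n))`. -/
noncomputable def aSeq {Ω : Type*} [MeasurableSpace Ω] (μ : Measure Ω) (χ : Ω → ℝ)
    (f : ℕ → ℝ) (n : ℕ) : ℝ :=
  n * (1 - distFun μ χ (f n))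

/-- `d_n = n ∫_0^{f_n} x dF(x)`. -/
noncomputable def dSeq {Ω : Type*} [MeasurableSpace Ω] (μ : Measure Ω) (χ : Ω → ℝ)
    (f : ℕ → ℝ) (n : ℕ) : ℝ :=
  n * ∫ x in Set.Icc 0 (f n), x ∂(distFun μ χ).measure

/-! Cut the observable at the level `f n`. If at most `b n` of the first `n` values exceed it, the
trimmed sum is at most the sum of the truncated values, and falls short of it by at most `f n` times
the surplus of `b n` over the number of exceedances (`trimmedSum_mem_Icc`). Two almost sure facts
then suffice: the truncated sum is asymptotic to `d n`, and the number of exceedances stays within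
`W * max ...` of `a n`. The surplus is then at most `2 * W * max ... + 1`, which the hypothesis on
`f n / d n` makes negligible.

Both facts come from one Bernstein inequality, `PropertyC.exists_bernstein`. By the spectral gap,
the transfer operator is the mean plus a contraction. The integral of `∏ (1 + t * G ∘ T^i)` is the
mean of an iterate of `h ↦ U ((1 + t g) h)`. Splitting the iterates into mean and remainder, the
latter of relative size `O(|t|)`, bounds the integral by `exp (n m (t + C t²))` with `m = ∫ G`. As
for independent variables, the quadratic term carries the factor `m`; moreover `C` depends on `G`
only through a bound for its norm in `F`, hence is uniform over all levels.

For the truncated sums the exponent is of order `d n / f n`, which dominates `log n`, and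
Borel–Cantelli over `n` applies. For the exceedances only `log log n` is available, too little for a
union over `n`, and `f` need not be monotone. Times are therefore grouped into cells on which `n`
and `a n` are nearly constant. Counts are monotone in the time and in the level, so two tail events
control a whole cell. In the exponent, `log log n` pays for the sum over dyadic blocks and `i ^
(2ε)` for the sum over the integer part `i` of `a n`. -/

set_option linter.unusedSectionVars false

/-! ### Function algebras and the duality of the transfer operator -/

section FunctionAlgebra

variable {Ω : Type*} [MeasurableSpace Ω] {T : Ω → Ω} {μ : Measure Ω} [IsProbabilityMeasure μ]
  {F : Type*} [NormedCommRing F] [NormedAlgebra ℂ F] {ι : F →ₗ[ℂ] (Ω →ₘ[μ] ℂ)}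

theorem IsFunctionAlgebra.memLp_top (hι : IsFunctionAlgebra μ ι) (h : F) :
    MemLp (ι h) ∞ μ :=
  memLp_top_of_bound (ι h).aestronglyMeasurable ‖h‖ (hι.ae_norm_le h)

theorem IsFunctionAlgebra.integrable (hι : IsFunctionAlgebra μ ι) (h : F) :
    Integrable (ι h) μ :=
  (hι.memLp_top h).integrable le_top

theorem IsFunctionAlgebra.integrable_mul (hι : IsFunctionAlgebra μ ι) (h : F) {w : Ω → ℂ}
    (hw : MemLp w ∞ μ) : Integrable (fun x => ι h x * w x) μ :=
  (hw.mul (p := ∞) (q := ∞) (r := ∞) (hι.memLp_top h)).integrable le_top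

/-- Testing against the complex conjugate of the function itself gives its squared `L²` norm. -/
theorem IsFunctionAlgebra.eq_zero_of_integral_mul (hι : IsFunctionAlgebra μ ι) {h : F}
    (hh : ∀ w : Ω → ℂ, MemLp w ∞ μ → ∫ x, ι h x * w x ∂μ = 0) : h = 0 := by
  have h1 := hh (fun x => star (ι h x)) (hι.memLp_top h).star
  have h2 : ∫ x, ‖ι h x‖ ^ 2 ∂μ = 0 := by
    have : ∫ x, ((‖ι h x‖ ^ 2 : ℝ) : ℂ) ∂μ = 0 := by
      rw [← h1]
      refine integral_congr_ae (Eventually.of_forall fun x => ?_)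
      simp only [RCLike.star_def, Complex.mul_conj, Complex.normSq_eq_norm_sq]
    rw [integral_complex_ofReal] at this
    exact_mod_cast this
  have hint : Integrable (fun x => ‖ι h x‖ ^ 2) μ := by
    have := (hι.integrable_mul h (hι.memLp_top h)).norm
    refine this.congr (Eventually.of_forall fun x => ?_)
    simp only [norm_mul, pow_two]
  rw [integral_eq_zero_iff_of_nonneg (fun x => by positivity) hint] at h2
  apply hι.injective
  rw [map_zero]
  refine AEEqFun.ext ?_
  filter_upwards [h2, AEEqFun.coeFn_zero (α := Ω) (β := ℂ) (μ := μ)] with x hx h0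
  rw [h0]
  simpa using hx

/-- The integral as a bounded functional on a function algebra. -/
noncomputable def IsFunctionAlgebra.integralCLM (hι : IsFunctionAlgebra μ ι) : F →L[ℂ] ℂ :=
  LinearMap.mkContinuous
    { toFun := fun h => ∫ x, ι h x ∂μ
      map_add' := fun h k => by
        rw [map_add, integral_congr_ae (AEEqFun.coeFn_add _ _)]
        exact integral_add (hι.integrable h) (hι.integrable k)
      map_smul' := fun c h => by
        rw [map_smul, integral_congr_ae (AEEqFun.coeFn_smul _ _)]
        exact integral_const_mul c _ } 1 (fun h => by
        have := norm_integral_le_of_norm_le_const (μ := μ) (hι.ae_norm_le h)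
        simpa using this)

theorem IsFunctionAlgebra.integralCLM_apply (hι : IsFunctionAlgebra μ ι) (h : F) :
    hι.integralCLM h = ∫ x, ι h x ∂μ := rfl

theorem IsFunctionAlgebra.coe_one (hι : IsFunctionAlgebra μ ι) : ∀ᵐ x ∂μ, ι 1 x = 1 := by
  rw [hι.map_one]
  exact AEEqFun.coeFn_one

theorem IsFunctionAlgebra.integralCLM_one (hι : IsFunctionAlgebra μ ι) :
    hι.integralCLM 1 = 1 := by
  rw [hι.integralCLM_apply, integral_congr_ae hι.coe_one]
  simp

variable {U : F →L[ℂ] F}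

theorem integral_transfer (hι : IsFunctionAlgebra μ ι) {That : Lp ℂ 1 μ →L[ℂ] Lp ℂ 1 μ}
    (hT : IsTransferOperator T μ That) (hU : ∀ h : F, That (hι.toL1 h) = hι.toL1 (U h))
    (h : F) {w : Ω → ℂ} (hw : MemLp w ∞ μ) :
    ∫ x, ι (U h) x * w x ∂μ = ∫ x, ι h x * w (T x) ∂μ := by
  have := hT (hι.toL1 h) w hw
  rw [hU] at this
  exact this

theorem integral_transfer_pow (hT : MeasurePreserving T μ μ)
    (hU : ∀ (h : F) (w : Ω → ℂ), MemLp w ∞ μ →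
      ∫ x, ι (U h) x * w x ∂μ = ∫ x, ι h x * w (T x) ∂μ)
    (n : ℕ) (h : F) {w : Ω → ℂ} (hw : MemLp w ∞ μ) :
    ∫ x, ι ((U ^ n) h) x * w x ∂μ = ∫ x, ι h x * w (T^[n] x) ∂μ := by
  induction n generalizing w with
  | zero => simp
  | succ n ih =>
    rw [pow_succ', mul_apply_eq_comp, hU _ _ hw,
      ih (w := fun x => w (T x)) (hw.comp_measurePreserving hT)]
    simp only [Function.iterate_succ_apply']

/-- Dual form of the invariance of `μ`: pairing `U 1` with `w` gives `∫ w ∘ T = ∫ w`. -/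
theorem transfer_one (hι : IsFunctionAlgebra μ ι) (hT : MeasurePreserving T μ μ)
    (hU : ∀ (h : F) (w : Ω → ℂ), MemLp w ∞ μ →
      ∫ x, ι (U h) x * w x ∂μ = ∫ x, ι h x * w (T x) ∂μ) : U 1 = 1 := by
  rw [← sub_eq_zero]
  refine hι.eq_zero_of_integral_mul fun w hw => ?_
  have h1 : ∫ x, ι (U 1 - 1) x * w x ∂μ
      = ∫ x, ι (U 1) x * w x ∂μ - ∫ x, ι 1 x * w x ∂μ := by
    rw [← integral_sub (hι.integrable_mul _ hw) (hι.integrable_mul _ hw)]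
    refine integral_congr_ae ?_
    rw [map_sub]
    filter_upwards [AEEqFun.coeFn_sub (ι (U 1)) (ι 1)] with x hx
    rw [hx, Pi.sub_apply, sub_mul]
  have h2 : ∫ x, ι 1 x * w x ∂μ = ∫ x, w x ∂μ := by
    refine integral_congr_ae ?_
    filter_upwards [hι.coe_one] with x hx
    rw [hx, one_mul]
  have h3 : ∫ x, ι 1 x * w (T x) ∂μ = ∫ x, w (T x) ∂μ := by
    refine integral_congr_ae ?_
    filter_upwards [hι.coe_one] with x hx
    rw [hx, one_mul]
  have h4 : ∫ x, w (T x) ∂μ = ∫ x, w x ∂μ := by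
    have := integral_map (μ := μ) (φ := T) hT.measurable.aemeasurable (f := w)
      (by rw [hT.map_eq]; exact hw.aestronglyMeasurable)
    rw [hT.map_eq] at this
    exact this.symm
  rw [h1, hU _ _ hw, h2, h3, h4, sub_self]

theorem integralCLM_transfer (hι : IsFunctionAlgebra μ ι)
    (hU : ∀ (h : F) (w : Ω → ℂ), MemLp w ∞ μ →
      ∫ x, ι (U h) x * w x ∂μ = ∫ x, ι h x * w (T x) ∂μ) (h : F) :
    hι.integralCLM (U h) = hι.integralCLM h := by
  have := hU h (fun _ => 1) (memLp_const 1)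
  simpa [hι.integralCLM_apply] using this

/-- A vector with `U v = z v` for `‖z‖ > 1` would have unbounded correlations. -/
theorem norm_eigenvalue_le_one (hι : IsFunctionAlgebra μ ι) (hT : MeasurePreserving T μ μ)
    (hU : ∀ (h : F) (w : Ω → ℂ), MemLp w ∞ μ →
      ∫ x, ι (U h) x * w x ∂μ = ∫ x, ι h x * w (T x) ∂μ)
    {z : ℂ} {v : F} (hv : v ≠ 0) (hz : U v = z • v) : ‖z‖ ≤ 1 := by
  by_contra! hlt
  apply hv
  refine hι.eq_zero_of_integral_mul fun w hw => ?_
  have hpow : ∀ n : ℕ, (U ^ n) v = z ^ n • v := by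
    intro n
    induction n with
    | zero => simp
    | succ n ih =>
      rw [pow_succ', mul_apply_eq_comp, ih, map_smul, hz, smul_smul, pow_succ]
  -- The correlation of `v` with `w ∘ T^n` is bounded in `n`, but it equals `z ^ n` times the
  -- pairing of `v` with `w`.
  have key : ∀ n : ℕ, ‖z‖ ^ n * ‖∫ x, ι v x * w x ∂μ‖ ≤ ‖v‖ * (eLpNorm w ∞ μ).toReal := by
    intro n
    have h1 : z ^ n * ∫ x, ι v x * w x ∂μ = ∫ x, ι v x * w (T^[n] x) ∂μ := by
      rw [← integral_transfer_pow hT hU n v hw, hpow, map_smul, ← integral_const_mul]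
      refine integral_congr_ae ?_
      filter_upwards [AEEqFun.coeFn_smul (z ^ n) (ι v)] with x hx
      rw [hx, Pi.smul_apply, smul_eq_mul, mul_assoc]
    rw [← norm_pow, ← norm_mul, h1]
    have hb : ∀ᵐ x ∂μ, ‖w x‖ ≤ (eLpNorm w ∞ μ).toReal := by
      filter_upwards [ae_le_eLpNormEssSup (f := w) (μ := μ)] with x hx
      have := ENNReal.toReal_mono hw.eLpNorm_ne_top (by simpa using hx)
      simpa using this
    have hb' := (hT.iterate n).quasiMeasurePreserving.ae hb
    have := norm_integral_le_of_norm_le_const (μ := μ)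
      (f := fun x => ι v x * w (T^[n] x)) (C := ‖v‖ * (eLpNorm w ∞ μ).toReal) (by
        filter_upwards [hb', hι.ae_norm_le v] with x h1 h2
        rw [norm_mul]
        gcongr)
    simpa using this
  by_contra hne
  have hpos : 0 < ‖∫ x, ι v x * w x ∂μ‖ := norm_pos_iff.2 hne
  have ht := (tendsto_pow_atTop_atTop_of_one_lt hlt).atTop_mul_const hpos
  obtain ⟨n, hn⟩ := (ht.eventually_gt_atTop (‖v‖ * (eLpNorm w ∞ μ).toReal)).exists
  exact absurd (key n) (not_le.2 hn)

end FunctionAlgebra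

/-! ### Spectral radius below one and adapted seminorms -/

section AdaptedSeminorm

variable {F : Type*} [NormedAddCommGroup F] [NormedSpace ℂ F]

theorem exists_norm_pow_le_of_spectralRadius_lt [CompleteSpace F] {N : F →L[ℂ] F}
    (h : spectralRadius ℂ N < 1) :
    ∃ ρ : ℝ, 0 < ρ ∧ ρ < 1 ∧ ∃ p : ℕ, 0 < p ∧ ‖N ^ p‖ ≤ ρ ^ p := by
  obtain ⟨r, hr1, hr2⟩ := exists_between h
  have hrt : r ≠ ∞ := (hr2.trans ENNReal.one_lt_top).ne
  have ht := spectrum.pow_nnnorm_pow_one_div_tendsto_nhds_spectralRadius N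
  obtain ⟨p, hp, hp0⟩ := ((ht.eventually_lt_const hr1).and (eventually_gt_atTop 0)).exists
  refine ⟨r.toReal, ENNReal.toReal_pos (ne_bot_of_gt hr1) hrt, ?_, p, hp0, ?_⟩
  · have := (ENNReal.toReal_lt_toReal hrt ENNReal.one_ne_top).2 hr2
    simpa using this
  · have h1 : ((‖N ^ p‖₊ : ℝ≥0∞) ^ (1 / p : ℝ)) ^ (p : ℝ) ≤ r ^ (p : ℝ) :=
      ENNReal.rpow_le_rpow hp.le (by positivity)
    rw [← ENNReal.rpow_mul, one_div_mul_cancel (by positivity), ENNReal.rpow_one,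
      ENNReal.rpow_natCast] at h1
    have := ENNReal.toReal_mono (by finiteness) h1
    simpa using this

theorem tendsto_pow_apply_of_norm_pow_le {N : F →L[ℂ] F} {ρ : ℝ} (h0 : 0 < ρ) (h1 : ρ < 1)
    {p : ℕ} (hp : 0 < p) (hN : ‖N ^ p‖ ≤ ρ ^ p) (v : F) :
    Tendsto (fun n : ℕ => (N ^ (p * n)) v) atTop (𝓝 0) := by
  have h2 : ρ ^ p < 1 := pow_lt_one₀ h0.le h1 hp.ne'
  have h3 : Tendsto (fun n : ℕ => (ρ ^ p) ^ n * ‖v‖) atTop (𝓝 0) := by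
    simpa using (tendsto_pow_atTop_nhds_zero_of_lt_one (by positivity) h2).mul_const ‖v‖
  refine squeeze_zero_norm (fun n => ?_) h3
  induction n with
  | zero => simp
  | succ n ih =>
    rw [mul_add, mul_one, add_comm, pow_add, mul_apply_eq_comp, pow_succ' (ρ ^ p),
      mul_assoc]
    exact ((N ^ p).le_opNorm _).trans (by gcongr)

/-- An operator some power of which contracts is a contraction in an equivalent seminorm. -/
theorem exists_seminorm_contracting {N : F →L[ℂ] F} {ρ : ℝ} (h0 : 0 < ρ)
    {p : ℕ} (hp : 0 < p) (hN : ‖N ^ p‖ ≤ ρ ^ p) :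
    ∃ (s : Seminorm ℂ F) (C : ℝ), 0 < C ∧ (∀ v, ‖v‖ ≤ s v) ∧ (∀ v, s v ≤ C * ‖v‖) ∧
      ∀ v, s (N v) ≤ ρ * s v := by
  let s : Seminorm ℂ F := Seminorm.of (fun v => ∑ k ∈ Finset.range p, ρ⁻¹ ^ k * ‖(N ^ k) v‖)
    (fun v w => by
      rw [← Finset.sum_add_distrib]
      refine Finset.sum_le_sum fun k _ => ?_
      rw [map_add, ← mul_add]
      gcongr
      exact norm_add_le _ _)
    (fun c v => by
      rw [Finset.mul_sum]
      refine Finset.sum_congr rfl fun k _ => ?_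
      rw [map_smul, norm_smul]
      ring)
  have hs : ∀ v, s v = ∑ k ∈ Finset.range p, ρ⁻¹ ^ k * ‖(N ^ k) v‖ := fun v => rfl
  refine ⟨s, 1 + ∑ k ∈ Finset.range p, ρ⁻¹ ^ k * ‖N ^ k‖, by positivity, ?_, ?_, ?_⟩
  · intro v
    rw [hs]
    have := Finset.single_le_sum (f := fun k => ρ⁻¹ ^ k * ‖(N ^ k) v‖) (s := Finset.range p)
      (fun k _ => by positivity) (Finset.mem_range.2 hp)
    simpa using this
  · intro v
    rw [hs, add_mul, Finset.sum_mul]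
    refine le_add_of_nonneg_of_le (by positivity) (Finset.sum_le_sum fun k _ => ?_)
    rw [mul_assoc]
    gcongr
    exact (N ^ k).le_opNorm v
  · intro v
    rw [hs, hs, Finset.mul_sum]
    have e1 : ∀ k ∈ Finset.range p, ρ⁻¹ ^ k * ‖(N ^ k) (N v)‖
        = ρ * (ρ⁻¹ ^ (k + 1) * ‖(N ^ (k + 1)) v‖) := by
      intro k _
      rw [pow_succ N, mul_apply_eq_comp, pow_succ ρ⁻¹]
      field_simp
    rw [Finset.sum_congr rfl e1, ← Finset.mul_sum, ← Finset.mul_sum]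
    refine mul_le_mul_of_nonneg_left ?_ h0.le
    -- Applying `N` shifts the weighted sum by one index. The new last term is dominated by the lost
    -- first term `‖v‖`, since `‖N ^ p‖ ≤ ρ ^ p`.
    have e2 := Finset.sum_range_succ (fun k => ρ⁻¹ ^ k * ‖(N ^ k) v‖) p
    have e3 := Finset.sum_range_succ' (fun k => ρ⁻¹ ^ k * ‖(N ^ k) v‖) p
    have e4 : ρ⁻¹ ^ p * ‖(N ^ p) v‖ ≤ ‖v‖ := by
      have := (N ^ p).le_of_opNorm_le hN v
      calc ρ⁻¹ ^ p * ‖(N ^ p) v‖ ≤ ρ⁻¹ ^ p * (ρ ^ p * ‖v‖) := by gcongr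
        _ = ‖v‖ := by rw [← mul_assoc, ← mul_pow, inv_mul_cancel₀ h0.ne', one_pow, one_mul]
    simp only [pow_zero, one_mul, one_apply_eq_self] at e3
    linarith

end AdaptedSeminorm

/-! ### The spectral projection is the mean -/

section SpectralGap

variable {Ω : Type*} [MeasurableSpace Ω] {T : Ω → Ω} {μ : Measure Ω} [IsProbabilityMeasure μ]
  {F : Type*} [NormedCommRing F] [NormedAlgebra ℂ F] [CompleteSpace F]
  {ι : F →ₗ[ℂ] (Ω →ₘ[μ] ℂ)} {U : F →L[ℂ] F}

/-- A transfer operator with a spectral gap contracts, in an equivalent seminorm, the distance to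
the mean. -/
theorem exists_seminorm_transfer_sub_integral (hι : IsFunctionAlgebra μ ι)
    (hT : MeasurePreserving T μ μ)
    (hU : ∀ (h : F) (w : Ω → ℂ), MemLp w ∞ μ →
      ∫ x, ι (U h) x * w x ∂μ = ∫ x, ι h x * w (T x) ∂μ)
    (hgap : HasSpectralGap U) :
    ∃ (s : Seminorm ℂ F) (C ρ : ℝ), 0 < C ∧ 0 < ρ ∧ ρ < 1 ∧ (∀ v, ‖v‖ ≤ s v) ∧
      (∀ v, s v ≤ C * ‖v‖) ∧ ∀ v, s (U v - hι.integralCLM v • 1) ≤ ρ * s v := by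
  obtain ⟨z, P, N, hUPN, hPP, hP1, hr, hPN, hNP⟩ := hgap
  have hUa : ∀ v, U v = z • P v + N v := fun v => by rw [hUPN]; rfl
  have hPPa : ∀ v, P (P v) = P v := fun v => DFunLike.congr_fun hPP v
  have hPNa : ∀ v, P (N v) = 0 := fun v => DFunLike.congr_fun hPN v
  have hNPa : ∀ v, N (P v) = 0 := fun v => DFunLike.congr_fun hNP v
  have hone : (1 : F) ≠ 0 := by
    intro h
    have := hι.integralCLM_one
    rw [h, map_zero] at this
    exact zero_ne_one this
  have hU1 : U 1 = 1 := transfer_one hι hT hU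
  obtain ⟨⟨v₀, u₀, hu₀⟩, hv₀, hspan⟩ := finrank_eq_one_iff'.1 hP1
  have hPv₀ : P v₀ = v₀ := by
    have : P u₀ = v₀ := hu₀
    rw [← this, hPPa]
  have hv₀' : v₀ ≠ 0 := fun h => hv₀ (Subtype.ext h)
  have hz1 : ‖z‖ ≤ 1 := by
    refine norm_eigenvalue_le_one hι hT hU hv₀' ?_
    rw [hUa, hPv₀]
    conv_lhs => rw [← hPv₀, hNPa, add_zero, hPv₀]
  have hr1 : spectralRadius ℂ N < 1 := by
    refine hr.trans_le ?_
    exact_mod_cast hz1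
  obtain ⟨ρ, hρ0, hρ1, p, hp, hNp⟩ := exists_norm_pow_le_of_spectralRadius_lt hr1
  have hlim := tendsto_pow_apply_of_norm_pow_le hρ0 hρ1 hp hNp
  have hP1z : P 1 = z • P 1 := by
    have := congrArg P hU1
    rw [hUa, map_add, map_smul, hPPa, hPNa, add_zero] at this
    exact this.symm
  -- Otherwise `N` would fix the constant `1`, although its powers along multiples of `p` tend to
  -- `0`.
  have hP1ne : P 1 ≠ 0 := by
    intro h
    have hN1 : N 1 = 1 := by
      have := hUa 1
      rw [hU1, h, smul_zero, zero_add] at this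
      exact this.symm
    have hNn : ∀ n : ℕ, (N ^ n) 1 = 1 := by
      intro n
      induction n with
      | zero => simp
      | succ n ih => rw [pow_succ', mul_apply_eq_comp, ih, hN1]
    have := hlim 1
    simp only [hNn] at this
    exact hone (tendsto_nhds_unique tendsto_const_nhds this)
  have hz : z = 1 := by
    have : (1 - z) • P 1 = 0 := by rw [sub_smul, one_smul, ← hP1z, sub_self]
    rcases smul_eq_zero.1 this with h | h
    · exact (sub_eq_zero.1 h).symm
    · exact absurd h hP1ne
  subst hz
  simp only [one_smul] at hUa
  -- The exponent must be positive: for exponent `0` the right-hand side would be `P v + v`.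
  have hUn : ∀ (n : ℕ) v, (U ^ (n + 1)) v = P v + (N ^ (n + 1)) v := by
    intro n v
    induction n with
    | zero => simp [hUa]
    | succ n ih =>
      rw [pow_succ', mul_apply_eq_comp, ih, hUa, map_add, map_add, hPPa, hNPa,
        pow_succ' N (n + 1), mul_apply_eq_comp, pow_succ' N n,
        mul_apply_eq_comp, hPNa]
      simp
  have hUn' : ∀ (n : ℕ) v, (U ^ (p * (n + 1))) v = P v + (N ^ (p * (n + 1))) v := by
    intro n v
    have : p * (n + 1) = (p * (n + 1) - 1) + 1 := by
      have : 0 < p * (n + 1) := by positivity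
      omega
    rw [this]
    exact hUn _ v
  have hU1n : ∀ n : ℕ, (U ^ n) 1 = 1 := by
    intro n
    induction n with
    | zero => simp
    | succ n ih => rw [pow_succ', mul_apply_eq_comp, ih, hU1]
  have hPone : P 1 = 1 := by
    have h1 : Tendsto (fun n : ℕ => (1 : F) - (N ^ (p * (n + 1))) 1) atTop (𝓝 (1 - 0)) :=
      tendsto_const_nhds.sub ((hlim 1).comp (tendsto_add_atTop_nat 1))
    have h2 : (fun n : ℕ => (1 : F) - (N ^ (p * (n + 1))) 1) = fun _ => P 1 := by
      funext n
      rw [sub_eq_iff_eq_add, ← hUn', hU1n]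
    rw [h2, sub_zero] at h1
    exact tendsto_nhds_unique tendsto_const_nhds h1
  have hIP : ∀ v, hι.integralCLM (P v) = hι.integralCLM v := by
    intro v
    have hIU : ∀ n : ℕ, hι.integralCLM ((U ^ n) v) = hι.integralCLM v := by
      intro n
      induction n with
      | zero => simp
      | succ n ih =>
        rw [pow_succ', mul_apply_eq_comp, integralCLM_transfer hι hU, ih]
    have h1 : Tendsto (fun n : ℕ => hι.integralCLM v - hι.integralCLM ((N ^ (p * (n + 1))) v))
        atTop (𝓝 (hι.integralCLM v - hι.integralCLM 0)) :=
      tendsto_const_nhds.sub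
        ((hι.integralCLM.continuous.tendsto 0).comp ((hlim v).comp (tendsto_add_atTop_nat 1)))
    have h2 : (fun n : ℕ => hι.integralCLM v - hι.integralCLM ((N ^ (p * (n + 1))) v))
        = fun _ => hι.integralCLM (P v) := by
      funext n
      rw [sub_eq_iff_eq_add, ← map_add, ← hUn', hIU]
    rw [h2, map_zero, sub_zero] at h1
    exact tendsto_nhds_unique tendsto_const_nhds h1
  -- The range of `P` is a line containing `1`, and `P` preserves the integral, which fixes the
  -- coefficient.
  have hPI : ∀ v, P v = hι.integralCLM v • 1 := by
    intro v
    obtain ⟨c₁, hc₁⟩ := hspan ⟨P 1, 1, rfl⟩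
    obtain ⟨c, hc⟩ := hspan ⟨P v, v, rfl⟩
    have hc₁' : c₁ • v₀ = 1 := by rw [← hPone]; exact congrArg Subtype.val hc₁
    have hc' : c • v₀ = P v := congrArg Subtype.val hc
    have hc₁0 : c₁ ≠ 0 := by
      rintro rfl
      rw [zero_smul] at hc₁'
      exact hone hc₁'.symm
    have h1 : P v = (c / c₁) • (1 : F) := by
      rw [← hc₁', smul_smul, div_mul_cancel₀ _ hc₁0, hc']
    have h2 := hIP v
    rw [h1, map_smul, hι.integralCLM_one, smul_eq_mul, mul_one] at h2
    rw [h1, h2]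
  obtain ⟨s, C, hC, h1, h2, h3⟩ := exists_seminorm_contracting hρ0 hp hNp
  refine ⟨s, C, ρ, hC, hρ0, hρ1, h1, h2, fun v => ?_⟩
  rw [hUa, hPI, add_sub_cancel_left]
  exact h3 v

end SpectralGap

/-! ### Exponential moments by perturbing the transfer operator -/

section Laplace

variable {Ω : Type*} [MeasurableSpace Ω] {T : Ω → Ω} {μ : Measure Ω} [IsProbabilityMeasure μ]
  {F : Type*} [NormedCommRing F] [NormedAlgebra ℂ F]
  {ι : F →ₗ[ℂ] (Ω →ₘ[μ] ℂ)} {U : F →L[ℂ] F}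

theorem integral_tilted_iterate (hι : IsFunctionAlgebra μ ι) (hT : MeasurePreserving T μ μ)
    (hU : ∀ (h : F) (w : Ω → ℂ), MemLp w ∞ μ →
      ∫ x, ι (U h) x * w x ∂μ = ∫ x, ι h x * w (T x) ∂μ)
    {k : F} {κ : Ω → ℂ} (hk : ∀ᵐ x ∂μ, ι k x = κ x) (hκ : MemLp κ ∞ μ) (n : ℕ)
    {w : Ω → ℂ} (hw : MemLp w ∞ μ) :
    ∫ x, ι ((fun h => U (k * h))^[n] 1) x * w x ∂μ
      = ∫ x, (∏ i ∈ Finset.range n, κ (T^[i] x)) * w (T^[n] x) ∂μ := by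
  induction n generalizing w with
  | zero =>
    refine integral_congr_ae ?_
    filter_upwards [hι.coe_one] with x hx
    simp [hx]
  | succ n ih =>
    rw [Function.iterate_succ_apply', hU _ _ hw]
    have hw' : MemLp (fun x => w (T x)) ∞ μ := hw.comp_measurePreserving hT
    have h1 := ih (w := fun x => κ x * w (T x)) (hw'.mul (p := ∞) (q := ∞) (r := ∞) hκ)
    have h2 : ∫ x, ι (k * (fun h => U (k * h))^[n] 1) x * w (T x) ∂μ
        = ∫ x, ι ((fun h => U (k * h))^[n] 1) x * (κ x * w (T x)) ∂μ := by
      refine integral_congr_ae ?_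
      rw [hι.map_mul]
      filter_upwards [hk, AEEqFun.coeFn_mul (ι k) (ι ((fun h => U (k * h))^[n] 1))] with x hx hm
      rw [hm, Pi.mul_apply, hx]
      ring
    rw [h2, h1]
    refine integral_congr_ae (Eventually.of_forall fun x => ?_)
    simp only [Finset.prod_range_succ, Function.iterate_succ_apply', mul_assoc]

/-- Using the `L¹` norm of `G` instead of `‖g‖` is what puts the mean into the quadratic error term
of the moment bound. -/
theorem norm_integralCLM_mul_le (hι : IsFunctionAlgebra μ ι) {g : F} {G : Ω → ℝ}
    (hG0 : ∀ x, 0 ≤ G x) (hg : ∀ᵐ x ∂μ, ι g x = (G x : ℂ)) (r : F) :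
    ‖hι.integralCLM (g * r)‖ ≤ (∫ x, G x ∂μ) * ‖r‖ := by
  have hGi : Integrable G μ := by
    refine (hι.integrable g).norm.congr ?_
    filter_upwards [hg] with x hx
    rw [hx, Complex.norm_real, Real.norm_of_nonneg (hG0 x)]
  rw [hι.integralCLM_apply, ← integral_mul_const]
  refine norm_integral_le_of_norm_le (hGi.mul_const _) ?_
  rw [hι.map_mul]
  filter_upwards [hg, AEEqFun.coeFn_mul (ι g) (ι r), hι.ae_norm_le r] with x hx hm hr
  rw [hm, Pi.mul_apply, hx, norm_mul, Complex.norm_real, Real.norm_of_nonneg (hG0 x)]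
  exact mul_le_mul_of_nonneg_left hr (hG0 x)

theorem integralCLM_eq_ofReal (hι : IsFunctionAlgebra μ ι) {g : F} {G : Ω → ℝ}
    (hg : ∀ᵐ x ∂μ, ι g x = (G x : ℂ)) : hι.integralCLM g = ((∫ x, G x ∂μ : ℝ) : ℂ) := by
  rw [hι.integralCLM_apply, integral_congr_ae hg, integral_complex_ofReal]

/-- The quadratic error term is proportional to the mean of `G`. -/
theorem exists_integral_prod_le [CompleteSpace F] (hι : IsFunctionAlgebra μ ι)
    (hT : MeasurePreserving T μ μ)
    (hU : ∀ (h : F) (w : Ω → ℂ), MemLp w ∞ μ →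
      ∫ x, ι (U h) x * w x ∂μ = ∫ x, ι h x * w (T x) ∂μ)
    (hgap : HasSpectralGap U) {K : ℝ} (hK : 0 < K) :
    ∃ t₀ C : ℝ, 0 < t₀ ∧ t₀ ≤ 1 / 2 ∧ 0 < C ∧
      ∀ (G : Ω → ℝ) (g : F), Measurable G → (∀ x, 0 ≤ G x) → (∀ x, G x ≤ 1) →
        (∀ᵐ x ∂μ, ι g x = (G x : ℂ)) → ‖g‖ ≤ K → ∀ t : ℝ, |t| ≤ t₀ → ∀ n : ℕ,
          ∫ x, ∏ i ∈ Finset.range n, (1 + t * G (T^[i] x)) ∂μ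
            ≤ Real.exp (n * (t * (∫ x, G x ∂μ) + C * t ^ 2 * ∫ x, G x ∂μ)) := by
  obtain ⟨s, C₀, ρ, hC₀, hρ0, hρ1, hs1, hs2, hs3⟩ :=
    exists_seminorm_transfer_sub_integral hι hT hU hgap
  set A : ℝ := C₀ * K * (‖(1 : F)‖ + 1) with hA
  have hApos : 0 < A := by positivity
  set B : ℝ := 4 * A / (1 - ρ) with hB
  have hρ' : 0 < 1 - ρ := by linarith
  have hBpos : 0 < B := by positivity
  -- The bound `1 / 2` keeps the factors `1 + t * G` positive, `(1 - ρ) / 4` closes the induction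
  -- for the remainder, and `1 / B` makes the remainder at most the mean.
  refine ⟨min (1 / 2) (min ((1 - ρ) / 4) (1 / B)), B, by positivity, min_le_left _ _, hBpos, ?_⟩
  intro G g hGm hG0 hG1 hg hgK t ht n
  set m : ℝ := ∫ x, G x ∂μ with hm
  have ht1 : |t| ≤ 1 / 2 := ht.trans (min_le_left _ _)
  have ht2 : |t| ≤ (1 - ρ) / 4 := ht.trans ((min_le_right _ _).trans (min_le_left _ _))
  have ht3 : B * |t| ≤ 1 := by
    have := ht.trans ((min_le_right _ _).trans (min_le_right _ _))
    rwa [le_div_iff₀ hBpos, mul_comm] at this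
  have hm0 : 0 ≤ m := integral_nonneg hG0
  have hm1 : m ≤ 1 := by
    have := integral_mono_of_nonneg (μ := μ) (Eventually.of_forall hG0) (integrable_const (1 : ℝ))
      (Eventually.of_forall hG1)
    simpa using this
  set I := hι.integralCLM with hI
  have hIg : I g = (m : ℂ) := integralCLM_eq_ofReal hι hg
  set k : F := 1 + (t : ℂ) • g with hk
  set h : ℕ → F := fun n => (fun h => U (k * h))^[n] 1 with hh
  have hsucc : ∀ n, h (n + 1) = U (k * h n) := fun n => Function.iterate_succ_apply' _ _ _
  -- The remainder has mean zero. It is driven only by the perturbation `t g`, and `U` contracts it.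
  set r : ℕ → F := fun n => h n - I (h n) • 1 with hr
  have hdec : ∀ n, h n = I (h n) • 1 + r n := fun n => by simp [hr]
  have hαsucc : ∀ n, I (h (n + 1)) = I (h n) * (1 + t * m) + t * I (g * r n) := by
    intro n
    have e1 : I (h (n + 1)) = I (k * h n) := by rw [hsucc, hI, integralCLM_transfer hι hU]
    have e2 : k * h n = h n + (t : ℂ) • (I (h n) • g + g * r n) := by
      conv_lhs => rw [hk, add_mul, one_mul, smul_mul_assoc]
      congr 2
      conv_lhs => rw [hdec n, mul_add, mul_smul_comm, mul_one]
    rw [e1, e2, map_add, map_smul, map_add, map_smul, hIg]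
    simp only [smul_eq_mul]
    ring
  have hIgr : ∀ n, ‖I (g * r n)‖ ≤ m * s (r n) := fun n =>
    (norm_integralCLM_mul_le hι hG0 hg (r n)).trans (mul_le_mul_of_nonneg_left (hs1 _) hm0)
  have hrsucc : ∀ n, s (r (n + 1)) ≤ ρ * s (r n) + |t| * (A * (‖I (h n)‖ + s (r n))) := by
    intro n
    have e1 : r (n + 1) = (U (r n) - I (r n) • 1)
        + (t : ℂ) • (U (g * h n) - I (g * h n) • 1) := by
      have hU1 : U 1 = 1 := transfer_one hι hT hU
      have hI1 : I 1 = 1 := hι.integralCLM_one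
      have e0 : I (h (n + 1)) = I (k * h n) := by rw [hsucc, hI, integralCLM_transfer hι hU]
      simp only [hr]
      rw [e0, hsucc]
      simp only [hk, add_mul, one_mul, smul_mul_assoc, map_add, map_smul, map_sub, hU1, hI1,
        smul_eq_mul, smul_sub, sub_smul, add_smul, smul_smul, mul_one]
      abel
    have e2 : s (U (g * h n) - I (g * h n) • 1) ≤ A * (‖I (h n)‖ + s (r n)) := by
      have e3 : ‖h n‖ ≤ (‖(1 : F)‖ + 1) * (‖I (h n)‖ + s (r n)) := by
        calc ‖h n‖ = ‖I (h n) • (1 : F) + r n‖ := by rw [← hdec]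
          _ ≤ ‖I (h n)‖ * ‖(1 : F)‖ + s (r n) :=
            (norm_add_le _ _).trans (add_le_add (norm_smul_le _ _) (hs1 _))
          _ ≤ _ := by
            have := mul_nonneg (norm_nonneg (1 : F)) (apply_nonneg s (r n))
            nlinarith [norm_nonneg (I (h n)), this]
      calc s (U (g * h n) - I (g * h n) • 1) ≤ ρ * s (g * h n) := hs3 _
        _ ≤ 1 * s (g * h n) := by gcongr
        _ ≤ C₀ * (‖g‖ * ‖h n‖) := by
          rw [one_mul]
          exact (hs2 _).trans (mul_le_mul_of_nonneg_left (norm_mul_le _ _) hC₀.le)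
        _ ≤ C₀ * (K * ((‖(1 : F)‖ + 1) * (‖I (h n)‖ + s (r n)))) := by gcongr
        _ = _ := by rw [hA]; ring
    rw [e1]
    refine (map_add_le_add s _ _).trans (add_le_add (hs3 _) ?_)
    rw [map_smul_eq_mul, Complex.norm_real, Real.norm_eq_abs]
    exact mul_le_mul_of_nonneg_left e2 (abs_nonneg _)
  have habs1 : |1 + t * m| = 1 + t * m := by
    refine abs_of_nonneg ?_
    have := neg_abs_le (t * m)
    rw [abs_mul, abs_of_nonneg hm0] at this
    nlinarith [abs_nonneg t]
  have hnorm1 : ‖(1 : ℂ) + t * m‖ = 1 + t * m := by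
    rw [← habs1, ← Complex.ofReal_mul, ← Complex.ofReal_one, ← Complex.ofReal_add,
      Complex.norm_real, Real.norm_eq_abs]
  have htm : 1 - |t| * m ≤ 1 + t * m := by
    have := neg_abs_le (t * m)
    rw [abs_mul, abs_of_nonneg hm0] at this
    linarith
  have herr : ∀ n, ‖(t : ℂ) * I (g * r n)‖ ≤ |t| * (m * s (r n)) := by
    intro n
    rw [norm_mul, Complex.norm_real, Real.norm_eq_abs]
    exact mul_le_mul_of_nonneg_left (hIgr n) (abs_nonneg _)
  -- The remainder is compared with the current mean, so the induction also needs that one step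
  -- shrinks the mean by at most the factor `1 - 2|t|`. The value of `B` is such that `B (1 - ρ) =
  -- 4A`, which absorbs both losses.
  have hrn : ∀ n, s (r n) ≤ B * |t| * ‖I (h n)‖ := by
    intro n
    induction n with
    | zero =>
      have : r 0 = 0 := by simp [hr, hh, hι.integralCLM_one, hI]
      rw [this, map_zero]
      positivity
    | succ n ih =>
      set a := ‖I (h n)‖ with ha
      have ha0 : 0 ≤ a := norm_nonneg _
      have hlow : a * (1 - 2 * |t|) ≤ ‖I (h (n + 1))‖ := by
        have h1 : a * (1 + t * m) - |t| * (m * s (r n)) ≤ ‖I (h (n + 1))‖ := by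
          rw [hαsucc, ha, ← hnorm1, ← norm_mul]
          have := norm_sub_le_norm_add (I (h n) * (1 + t * m)) ((t : ℂ) * I (g * r n))
          linarith [herr n]
        have h2 : s (r n) ≤ a := ih.trans (by nlinarith)
        have h3 : |t| * (m * s (r n)) ≤ |t| * (1 * a) := by gcongr
        have h4 : a * (1 - |t| * 1) ≤ a * (1 + t * m) := by
          refine mul_le_mul_of_nonneg_left (le_trans ?_ htm) ha0
          have := mul_le_mul_of_nonneg_left hm1 (abs_nonneg t)
          linarith
        linarith
      have h5 : s (r (n + 1)) ≤ |t| * a * (ρ * B + 2 * A) := by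
        have h2 : s (r n) ≤ a := ih.trans (by nlinarith)
        calc s (r (n + 1)) ≤ ρ * s (r n) + |t| * (A * (a + s (r n))) := hrsucc n
          _ ≤ ρ * (B * |t| * a) + |t| * (A * (a + a)) := by gcongr
          _ = _ := by ring
      have h6 : ρ * B + 2 * A ≤ B * (1 - 2 * |t|) := by
        have : B * (1 - ρ) = 4 * A := by rw [hB]; field_simp
        nlinarith
      calc s (r (n + 1)) ≤ |t| * a * (ρ * B + 2 * A) := h5
        _ ≤ |t| * a * (B * (1 - 2 * |t|)) := by gcongr
        _ = B * |t| * (a * (1 - 2 * |t|)) := by ring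
        _ ≤ _ := by gcongr
  have hαn : ∀ n : ℕ, ‖I (h n)‖ ≤ Real.exp (n * (t * m + B * t ^ 2 * m)) := by
    intro n
    induction n with
    | zero => simp [hh, hI, hι.integralCLM_one]
    | succ n ih =>
      have h1 : ‖I (h (n + 1))‖ ≤ ‖I (h n)‖ * (1 + (t * m + B * t ^ 2 * m)) := by
        rw [hαsucc]
        refine (norm_add_le _ _).trans ?_
        rw [norm_mul, hnorm1]
        have h2 : |t| * (m * s (r n)) ≤ |t| * (m * (B * |t| * ‖I (h n)‖)) := by
          have := hrn n
          gcongr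
        have h3 : |t| * (m * (B * |t| * ‖I (h n)‖)) = B * t ^ 2 * m * ‖I (h n)‖ := by
          rw [← sq_abs t]; ring
        linarith [herr n]
      refine h1.trans ?_
      have h4 := Real.add_one_le_exp (t * m + B * t ^ 2 * m)
      calc ‖I (h n)‖ * (1 + (t * m + B * t ^ 2 * m))
          ≤ ‖I (h n)‖ * Real.exp (t * m + B * t ^ 2 * m) := by gcongr; linarith
        _ ≤ Real.exp (n * (t * m + B * t ^ 2 * m)) * Real.exp (t * m + B * t ^ 2 * m) := by
          gcongr
        _ = _ := by rw [← Real.exp_add]; push_cast; ring_nf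
  refine le_trans ?_ (hαn n)
  have hκ : MemLp (fun x => ((1 + t * G x : ℝ) : ℂ)) ∞ μ := by
    refine memLp_top_of_bound
      (Complex.measurable_ofReal.comp ((hGm.const_mul t).const_add 1)).aestronglyMeasurable
      (1 + |t|) (Eventually.of_forall fun x => ?_)
    rw [Complex.norm_real, Real.norm_eq_abs]
    refine (abs_add_le _ _).trans ?_
    rw [abs_one, abs_mul, abs_of_nonneg (hG0 x)]
    nlinarith [hG1 x, abs_nonneg t]
  have hkκ : ∀ᵐ x ∂μ, ι k x = ((1 + t * G x : ℝ) : ℂ) := by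
    rw [hk, map_add, map_smul]
    filter_upwards [hg, hι.coe_one, AEEqFun.coeFn_smul (t : ℂ) (ι g),
      AEEqFun.coeFn_add (ι 1) ((t : ℂ) • ι g)] with x h1 h2 h3 h4
    rw [h4, Pi.add_apply, h3, Pi.smul_apply, h1, h2]
    simp
  have hmain := integral_tilted_iterate hι hT hU hkκ hκ n (memLp_const (1 : ℂ))
  have hmain' : I (h n) = ((∫ x, ∏ i ∈ Finset.range n, (1 + t * G (T^[i] x)) ∂μ : ℝ) : ℂ) := by
    rw [← integral_complex_ofReal]
    simpa [hι.integralCLM_apply, hI, hh] using hmain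
  rw [hmain', Complex.norm_real]
  exact le_abs_self _

end Laplace

/-! ### From exponential moments to tail bounds -/

section Tails

variable {Ω : Type*} [MeasurableSpace Ω]

/-- Bernoulli's inequality `(1 + t) ^ y ≤ 1 + t y` for `0 ≤ y ≤ 1`, multiplied along the orbit. -/
theorem exp_log_mul_birkhoffSum_le_prod {T : Ω → Ω} {G : Ω → ℝ} (hG0 : ∀ x, 0 ≤ G x)
    (hG1 : ∀ x, G x ≤ 1) {t : ℝ} (ht : -1 < t) (n : ℕ) (x : Ω) :
    Real.exp (Real.log (1 + t) * ∑ i ∈ Finset.range n, G (T^[i] x))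
      ≤ ∏ i ∈ Finset.range n, (1 + t * G (T^[i] x)) := by
  rw [Finset.mul_sum, Real.exp_sum]
  refine Finset.prod_le_prod (fun i _ => (Real.exp_pos _).le) fun i _ => ?_
  rw [← Real.rpow_def_of_pos (by linarith), mul_comm t]
  exact rpow_one_add_le_one_add_mul_self ht.le (hG0 _) (hG1 _)

theorem integrable_prod_one_add {T : Ω → Ω} {μ : Measure Ω} [IsProbabilityMeasure μ]
    (hT : Measurable T) {G : Ω → ℝ} (hGm : Measurable G) (hG0 : ∀ x, 0 ≤ G x)
    (hG1 : ∀ x, G x ≤ 1) (t : ℝ) (n : ℕ) :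
    Integrable (fun x => ∏ i ∈ Finset.range n, (1 + t * G (T^[i] x))) μ := by
  refine Integrable.of_bound (C := (1 + |t|) ^ n) ?_ (Eventually.of_forall fun x => ?_)
  · refine (Finset.measurable_fun_prod _ fun i _ => ?_).aestronglyMeasurable
    exact ((hGm.comp (hT.iterate i)).const_mul t).const_add 1
  · rw [norm_prod]
    calc ∏ i ∈ Finset.range n, ‖1 + t * G (T^[i] x)‖ ≤ ∏ i ∈ Finset.range n, (1 + |t|) := by
          refine Finset.prod_le_prod (fun i _ => norm_nonneg _) fun i _ => ?_
          rw [Real.norm_eq_abs]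
          refine (abs_add_le _ _).trans ?_
          rw [abs_one, abs_mul, abs_of_nonneg (hG0 _)]
          nlinarith [hG1 (T^[i] x), abs_nonneg t]
      _ = _ := by simp

theorem measureReal_le_of_exp_le {μ : Measure Ω} [IsProbabilityMeasure μ] {X : Ω → ℝ}
    (hX0 : 0 ≤ X) (hX : Integrable X μ) {a b : ℝ} {E : Set Ω} (hE : ∀ x ∈ E, Real.exp a ≤ X x)
    (hb : ∫ x, X x ∂μ ≤ Real.exp b) : μ.real E ≤ Real.exp (b - a) := by
  have h1 : Real.exp a * μ.real E ≤ Real.exp b :=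
    calc Real.exp a * μ.real E ≤ Real.exp a * μ.real {x | Real.exp a ≤ X x} := by
          refine mul_le_mul_of_nonneg_left (measureReal_mono hE) (Real.exp_pos _).le
      _ ≤ ∫ x, X x ∂μ := mul_meas_ge_le_integral_of_nonneg (Eventually.of_forall hX0) hX _
      _ ≤ _ := hb
  rw [Real.exp_sub, le_div_iff₀ (Real.exp_pos _), mul_comm]
  exact h1

/-- A Bernstein inequality for the Birkhoff sums of a `[0, 1]`-valued function, whose constants
depend only on the bound `K` for its norm. -/
theorem PropertyC.exists_bernstein {T : Ω → Ω} {μ : Measure Ω} [IsProbabilityMeasure μ]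
    {F : Type*} [NormedCommRing F] [NormedAlgebra ℂ F] [CompleteSpace F]
    {ι : F →ₗ[ℂ] (Ω →ₘ[μ] ℂ)} (hC : PropertyC T μ ι) {K : ℝ} (hK : 0 < K) :
    ∃ t₀ C : ℝ, 0 < t₀ ∧ 0 < C ∧
      ∀ (G : Ω → ℝ) (g : F), Measurable G → (∀ x, 0 ≤ G x) → (∀ x, G x ≤ 1) →
        (∀ᵐ x ∂μ, ι g x = (G x : ℂ)) → ‖g‖ ≤ K → ∀ t : ℝ, 0 ≤ t → t ≤ t₀ → ∀ (n : ℕ) (u : ℝ),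
          0 ≤ u →
          μ.real {x | n * (∫ y, G y ∂μ) + u ≤ ∑ i ∈ Finset.range n, G (T^[i] x)}
            ≤ Real.exp (-(t * u / 2) + C * t ^ 2 * (n * ∫ y, G y ∂μ)) ∧
          μ.real {x | ∑ i ∈ Finset.range n, G (T^[i] x) ≤ n * (∫ y, G y ∂μ) - u}
            ≤ Real.exp (-(t * u / 2) + C * t ^ 2 * (n * ∫ y, G y ∂μ)) := by
  obtain ⟨That, hThat, U, hU, hgap⟩ := hC.transfer
  obtain ⟨t₀, C, ht₀, ht₀', hCpos, hmain⟩ :=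
    exists_integral_prod_le hC.isFunctionAlgebra hC.measurePreserving
      (fun h w hw => integral_transfer hC.isFunctionAlgebra hThat hU h hw) hgap hK
  -- Replacing `log (1 + t)` by `t - t²` and `log (1 - t)` by `-t - 2t²` costs at most `2t²` times
  -- the mean.
  refine ⟨t₀, C + 2, ht₀, by positivity, ?_⟩
  intro G g hGm hG0 hG1 hg hgK t ht0 ht n u hu
  set m := ∫ y, G y ∂μ with hm
  have hm0 : 0 ≤ m := integral_nonneg hG0
  have hnm : 0 ≤ n * m := by positivity
  have ht2 : t ≤ 1 / 2 := ht.trans ht₀'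
  have hprod0 : ∀ t' : ℝ, -1 < t' → 0 ≤ fun x => ∏ i ∈ Finset.range n, (1 + t' * G (T^[i] x)) :=
    fun t' ht' x => (Real.exp_pos _).le.trans (exp_log_mul_birkhoffSum_le_prod hG0 hG1 ht' n x)
  constructor
  · have hlog : t - t ^ 2 ≤ Real.log (1 + t) := by
      refine le_trans ?_ (Real.one_sub_inv_le_log_of_pos (by linarith))
      have : 1 - (1 + t)⁻¹ = t / (1 + t) := by field_simp; ring
      rw [this, le_div_iff₀ (by linarith)]
      nlinarith [pow_nonneg ht0 3]
    have hlog0 : 0 ≤ Real.log (1 + t) := Real.log_nonneg (by linarith)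
    have h1 := measureReal_le_of_exp_le (μ := μ) (hprod0 t (by linarith))
      (integrable_prod_one_add hC.measurePreserving.measurable hGm hG0 hG1 t n)
      (a := Real.log (1 + t) * (n * m + u))
      (E := {x | n * m + u ≤ ∑ i ∈ Finset.range n, G (T^[i] x)})
      (fun x hx => (Real.exp_le_exp.2 (mul_le_mul_of_nonneg_left hx hlog0)).trans
        (exp_log_mul_birkhoffSum_le_prod hG0 hG1 (by linarith) n x))
      (hmain G g hGm hG0 hG1 hg hgK t (by rwa [abs_of_nonneg ht0]) n)
    refine h1.trans (Real.exp_le_exp.2 ?_)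
    have h2 : (t - t ^ 2) * (n * m + u) ≤ Real.log (1 + t) * (n * m + u) := by gcongr
    have h3 : t ^ 2 * u ≤ t * u / 2 := by nlinarith [mul_nonneg ht0 hu]
    have h4 : 0 ≤ t ^ 2 * (n * m) := by positivity
    nlinarith
  -- For `u` above the mean the event is empty; otherwise `n * m - u` is nonnegative and may
  -- multiply the logarithmic bound.
  · rcases lt_or_ge (n * m) u with hlt | hge
    · have : {x | ∑ i ∈ Finset.range n, G (T^[i] x) ≤ n * m - u} = ∅ := by
        refine Set.eq_empty_of_forall_notMem fun x hx => ?_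
        have h1 : 0 ≤ ∑ i ∈ Finset.range n, G (T^[i] x) := Finset.sum_nonneg fun i _ => hG0 _
        have h2 : ∑ i ∈ Finset.range n, G (T^[i] x) ≤ n * m - u := hx
        linarith
      rw [this, measureReal_empty]
      positivity
    have hlog : -t - 2 * t ^ 2 ≤ Real.log (1 + -t) := by
      refine le_trans ?_ (Real.one_sub_inv_le_log_of_pos (by linarith))
      have h0 : 0 < 1 + -t := by linarith
      have : 1 - (1 + -t)⁻¹ = (-t) / (1 + -t) := by field_simp; ring
      rw [this, le_div_iff₀ h0]
      nlinarith [mul_nonneg (sq_nonneg t) (by linarith : 0 ≤ 1 - 2 * t)]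
    have hlog0 : Real.log (1 + -t) ≤ 0 := Real.log_nonpos (by linarith) (by linarith)
    have h1 := measureReal_le_of_exp_le (μ := μ) (hprod0 (-t) (by linarith))
      (integrable_prod_one_add hC.measurePreserving.measurable hGm hG0 hG1 (-t) n)
      (a := Real.log (1 + -t) * (n * m - u))
      (E := {x | ∑ i ∈ Finset.range n, G (T^[i] x) ≤ n * m - u})
      (fun x hx => (Real.exp_le_exp.2 (mul_le_mul_of_nonpos_left hx hlog0)).trans
        (exp_log_mul_birkhoffSum_le_prod hG0 hG1 (by linarith) n x))
      (hmain G g hGm hG0 hG1 hg hgK (-t) (by rwa [abs_neg, abs_of_nonneg ht0]) n)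
    refine h1.trans (Real.exp_le_exp.2 ?_)
    have h2 : (-t - 2 * t ^ 2) * (n * m - u) ≤ Real.log (1 + -t) * (n * m - u) := by
      have : 0 ≤ n * m - u := by linarith
      gcongr
    have h3 : 0 ≤ t ^ 2 * u := by positivity
    have h4 : 0 ≤ t * u := by positivity
    nlinarith

end Tails

/-! ### Strong law for the truncated sums -/

section Observable

variable {Ω : Type*} [MeasurableSpace Ω] {T : Ω → Ω} {μ : Measure Ω} [IsProbabilityMeasure μ]
  {χ : Ω → ℝ}

theorem ae_finite_setOf_mem_of_summable {κ : Type*} [Countable κ] {s : κ → Set Ω} {w : κ → ℝ} (hw : Summable w)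
    (h : ∀ᶠ i in cofinite, μ.real (s i) ≤ w i) : ∀ᵐ x ∂μ, {i | x ∈ s i}.Finite := by
  refine ae_finite_setOfPred_mem ?_
  have h1 : Summable fun i => μ.real (s i) := by
    refine Summable.of_norm_bounded_eventually hw ?_
    filter_upwards [h] with i hi
    rwa [Real.norm_of_nonneg measureReal_nonneg]
  have h2 := h1.tsum_ofReal_ne_top
  simpa using h2

theorem measurable_truncate (hχ : Measurable χ) (ℓ : ℝ) : Measurable (truncate χ ℓ) :=
  hχ.indicator (measurableSet_le hχ measurable_const)

theorem truncate_nonneg (h0 : ∀ x, 0 ≤ χ x) (ℓ : ℝ) (x : Ω) : 0 ≤ truncate χ ℓ x :=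
  Set.indicator_nonneg (fun y _ => h0 y) x

theorem truncate_le {ℓ : ℝ} (hℓ : 0 ≤ ℓ) (x : Ω) : truncate χ ℓ x ≤ ℓ :=
  Set.indicator_le' (fun _ hy => hy) (fun _ _ => hℓ) x

theorem mul_integral_truncate (hχ : Measurable χ) (h0 : ∀ x, 0 ≤ χ x) (f : ℕ → ℝ) (n : ℕ) :
    n * ∫ x, truncate χ (f n) x ∂μ = dSeq μ χ f n := by
  have := Measure.isProbabilityMeasure_map (μ := μ) hχ.aemeasurable
  rw [dSeq, distFun, measure_cdf,
    setIntegral_map (g := χ) (f := fun x : ℝ => x) measurableSet_Icc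
      measurable_id.aestronglyMeasurable hχ.aemeasurable]
  congr 1
  rw [← integral_indicator (hχ measurableSet_Icc)]
  congr 1
  funext x
  have : χ ⁻¹' Set.Icc 0 (f n) = {x | χ x ≤ f n} := by
    ext y
    simp [h0 y]
  rw [truncate, this]

theorem integral_indicator_lt (hχ : Measurable χ) (f : ℕ → ℝ) (n : ℕ) :
    ∫ x, {y | f n < χ y}.indicator (fun _ => (1 : ℝ)) x ∂μ = 1 - distFun μ χ (f n) := by
  have := Measure.isProbabilityMeasure_map (μ := μ) hχ.aemeasurable
  rw [integral_indicator_const _ (measurableSet_lt measurable_const hχ), distFun, cdf_eq_real,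
    map_measureReal_apply hχ measurableSet_Iic, smul_eq_mul, mul_one]
  have h1 : {y | f n < χ y} = (χ ⁻¹' Set.Iic (f n))ᶜ := by
    ext y
    simp
  rw [h1, probReal_compl_eq_one_sub (hχ measurableSet_Iic)]

variable {F : Type*} [NormedCommRing F] [NormedAlgebra ℂ F] [CompleteSpace F]
  {ι : F →ₗ[ℂ] (Ω →ₘ[μ] ℂ)}

/-- The truncated Birkhoff sums obey the strong law of large numbers when `d_n / f_n` dominates
`log n`. -/
theorem PropertyD.ae_tendsto_truncatedSum_div (hD : PropertyD T μ ι χ) {f : ℕ → ℝ}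
    (hf : ∀ n, 0 < f n) (hd : ∀ᶠ n in atTop, 0 < dSeq μ χ f n)
    (hlim : Tendsto (fun n : ℕ => f n / dSeq μ χ f n * Real.log n) atTop (𝓝 0)) :
    ∀ᵐ x ∂μ, Tendsto (fun n : ℕ =>
      (∑ i ∈ Finset.range n, truncate χ (f n) (T^[i] x)) / dSeq μ χ f n) atTop (𝓝 1) := by
  obtain ⟨K, hK, hKb⟩ := hD.norm_truncate_le
  obtain ⟨t₀, C, ht₀, hC, hB⟩ := hD.propertyC.exists_bernstein hK
  set S : ℕ → Ω → ℝ := fun n x => ∑ i ∈ Finset.range n, truncate χ (f n) (T^[i] x) with hS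
  set d := dSeq μ χ f with hd'
  have key : ∀ q : ℕ, ∀ᵐ x ∂μ, ∀ᶠ n in atTop, |S n x / d n - 1| < 1 / (q + 1) := by
    intro q
    set δ : ℝ := 1 / (q + 1) with hδ
    have hδ0 : 0 < δ := by positivity
    -- The quadratic term then takes at most half of the linear gain `tδ/2`. What remains, `(tδ/4) d
    -- n / f n`, exceeds `2 log n` as soon as `log n < (tδ/8) d n / f n`.
    set t : ℝ := min t₀ (δ / (4 * C)) with ht
    have ht0 : 0 < t := lt_min ht₀ (by positivity)
    have htC : C * t ≤ δ / 4 := by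
      have : t ≤ δ / (4 * C) := min_le_right _ _
      rw [le_div_iff₀ (by positivity)] at this
      linarith
    have hbad : ∀ᶠ n : ℕ in atTop, μ.real {x | δ ≤ |S n x / d n - 1|} ≤ 2 * ((n : ℝ) ^ 2)⁻¹ := by
      have hsmall := hlim.eventually_lt_const (u := t * δ / 8) (by positivity)
      filter_upwards [hd, hsmall, eventually_gt_atTop 0] with n hdn hsn hn
      obtain ⟨h, hh, hhK⟩ := hKb (f n) (hf n)
      have hmean : n * ∫ y, truncate χ (f n) y / f n ∂μ = d n / f n := by
        rw [integral_div, ← mul_div_assoc, mul_integral_truncate hD.measurable hD.nonneg]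
      have hsum : ∀ x, ∑ i ∈ Finset.range n, truncate χ (f n) (T^[i] x) / f n = S n x / f n :=
        fun x => (Finset.sum_div _ _ _).symm
      -- Dividing by `f n` gives values in `[0, 1]` and a norm at most `K`, so the Bernstein
      -- constants do not depend on `n`.
      have hb := hB (fun x => truncate χ (f n) x / f n) (((f n)⁻¹ : ℂ) • h)
        ((measurable_truncate hD.measurable _).div_const _)
        (fun x => div_nonneg (truncate_nonneg hD.nonneg _ _) (hf n).le)
        (fun x => div_le_one_of_le₀ (truncate_le (hf n).le x) (hf n).le)
        (by
          rw [map_smul]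
          filter_upwards [hh, AEEqFun.coeFn_smul ((f n)⁻¹ : ℂ) (ι h)] with x h1 h2
          rw [h2, Pi.smul_apply, h1]
          push_cast
          rw [smul_eq_mul, mul_comm, div_eq_mul_inv])
        (by
          refine (norm_smul_le _ _).trans ?_
          rw [norm_inv, Complex.norm_real, Real.norm_of_nonneg (hf n).le,
            inv_mul_le_iff₀ (hf n), mul_comm]
          exact hhK)
        t ht0.le (min_le_left _ _) n (δ * (d n / f n)) (by have := hf n; positivity)
      simp only [hsum, hmean] at hb
      have hsub : {x | δ ≤ |S n x / d n - 1|} ⊆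
          {x | d n / f n + δ * (d n / f n) ≤ S n x / f n} ∪
            {x | S n x / f n ≤ d n / f n - δ * (d n / f n)} := by
        intro x hx
        have hfn := hf n
        have e1 : S n x / f n = d n / f n * (S n x / d n) := by field_simp
        have hpos : 0 < d n / f n := by positivity
        rcases le_abs.1 (show δ ≤ |S n x / d n - 1| from hx) with h1 | h1
        · left
          change d n / f n + δ * (d n / f n) ≤ S n x / f n
          rw [e1]
          nlinarith
        · right
          change S n x / f n ≤ d n / f n - δ * (d n / f n)
          rw [e1]
          nlinarith
      have hexp : Real.exp (-(t * (δ * (d n / f n)) / 2) + C * t ^ 2 * (d n / f n))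
          ≤ ((n : ℝ) ^ 2)⁻¹ := by
        have hn0 : (0 : ℝ) < n := by exact_mod_cast hn
        have e1 : ((n : ℝ) ^ 2)⁻¹ = Real.exp (-(2 * Real.log n)) := by
          rw [Real.exp_neg, two_mul, Real.exp_add, Real.exp_log hn0, pow_two]
        rw [e1, Real.exp_le_exp]
        have hfn := hf n
        have hpos : 0 < d n / f n := by positivity
        have h1 : Real.log n < t * δ / 8 * (d n / f n) := by
          have : f n / d n * Real.log n * (d n / f n) < t * δ / 8 * (d n / f n) := by gcongr
          calc Real.log n = f n / d n * Real.log n * (d n / f n) := by field_simp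
            _ < _ := this
        have h2 : C * t ^ 2 * (d n / f n) ≤ t * δ / 4 * (d n / f n) := by
          gcongr
          nlinarith
        linarith
      calc μ.real {x | δ ≤ |S n x / d n - 1|} ≤ _ := measureReal_mono hsub
        _ ≤ _ := measureReal_union_le _ _
        _ ≤ ((n : ℝ) ^ 2)⁻¹ + ((n : ℝ) ^ 2)⁻¹ :=
          add_le_add (hb.1.trans hexp) (hb.2.trans hexp)
        _ = _ := by ring
    rw [← Nat.cofinite_eq_atTop] at hbad
    have hw : Summable fun n : ℕ => 2 * ((n : ℝ) ^ 2)⁻¹ :=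
      (Real.summable_nat_pow_inv.2 (by norm_num)).mul_left 2
    filter_upwards [ae_finite_setOf_mem_of_summable hw hbad] with x hx
    rw [← Nat.cofinite_eq_atTop]
    filter_upwards [hx.compl_mem_cofinite] with n hn
    simpa using hn
  filter_upwards [ae_all_iff.2 key] with x hx
  rw [Metric.tendsto_atTop']
  intro e he
  obtain ⟨q, hq⟩ := exists_nat_one_div_lt he
  obtain ⟨n₀, hn₀⟩ := eventually_atTop.1 (hx q)
  exact ⟨n₀, fun n hn => by
    rw [Real.dist_eq]
    exact (hn₀ n hn.le).trans hq⟩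

end Observable

/-! ### Deterministic comparison of trimmed and truncated sums -/

section Trimming

variable {Ω : Type*} (T : Ω → Ω) (χ : Ω → ℝ)

theorem sum_orderPerm (g : Ω → ℝ) (n : ℕ) (x : Ω) :
    ∑ k : Fin n, g (T^[orderPerm T χ n x k] x) = ∑ i ∈ Finset.range n, g (T^[i] x) := by
  rw [Equiv.sum_comp (orderPerm T χ n x) (fun i : Fin n => g (T^[i] x)),
    Fin.sum_univ_eq_sum_range (fun i => g (T^[i] x)) n]

/-- If at most `b` terms exceed `ℓ`, then trimming `b` terms leaves at most the truncated sum, and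
removes at most `b` minus the number of exceedances further terms. -/
theorem trimmedSum_mem_Icc (h0 : ∀ x, 0 ≤ χ x) {ℓ : ℝ} (hℓ : 0 ≤ ℓ) {n b : ℕ} {x : Ω}
    (hb : ∑ i ∈ Finset.range n, {y | ℓ < χ y}.indicator (fun _ => (1 : ℝ)) (T^[i] x) ≤ b) :
    trimmedSum T χ n b x ≤ ∑ i ∈ Finset.range n, truncate χ ℓ (T^[i] x) ∧
    ∑ i ∈ Finset.range n, truncate χ ℓ (T^[i] x) -
        (b - ∑ i ∈ Finset.range n, {y | ℓ < χ y}.indicator (fun _ => (1 : ℝ)) (T^[i] x)) * ℓ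
      ≤ trimmedSum T χ n b x := by
  rw [← sum_orderPerm T χ] at hb
  rw [← sum_orderPerm T χ, ← sum_orderPerm T χ]
  have hanti := antitone_orderPerm T χ n x
  set z : Fin n → Ω := fun k => T^[orderPerm T χ n x k] x with hz
  change Antitone (fun k => χ (z k)) at hanti
  have hN : ∑ k : Fin n, {y | ℓ < χ y}.indicator (fun _ => (1 : ℝ)) (z k)
      = (Finset.univ.filter fun k : Fin n => ℓ < χ (z k)).card := by
    rw [Finset.card_filter]
    push_cast
    exact Finset.sum_congr rfl fun k _ => rfl
  change ∑ k : Fin n, {y | ℓ < χ y}.indicator (fun _ => (1 : ℝ)) (z k) ≤ b at hb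
  rw [hN, Nat.cast_le] at hb
  -- An exceedance at position `k`, counted from `0`, forces `k + 1 > b` exceedances by the
  -- ordering.
  have hsmall : ∀ k : Fin n, b ≤ (k : ℕ) → χ (z k) ≤ ℓ := by
    intro k hk
    by_contra! hlt
    have h1 : Finset.Iic k ⊆ Finset.univ.filter fun k : Fin n => ℓ < χ (z k) := by
      intro j hj
      rw [Finset.mem_filter]
      exact ⟨Finset.mem_univ _, hlt.trans_le (hanti (Finset.mem_Iic.1 hj))⟩
    have h2 := Finset.card_le_card h1
    rw [Fin.card_Iic] at h2
    omega
  have htrim : trimmedSum T χ n b x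
      = ∑ k ∈ Finset.univ.filter (fun k : Fin n => b ≤ (k : ℕ)), truncate χ ℓ (z k) := by
    refine Finset.sum_congr rfl fun k hk => ?_
    rw [truncate, Set.indicator_of_mem]
    exact hsmall k (Finset.mem_filter.1 hk).2
  have hsplit := Finset.sum_filter_add_sum_filter_not Finset.univ (fun k : Fin n => b ≤ (k : ℕ))
    (fun k => truncate χ ℓ (z k))
  have hnn : 0 ≤ ∑ k ∈ Finset.univ.filter (fun k : Fin n => ¬ b ≤ (k : ℕ)), truncate χ ℓ (z k) :=
    Finset.sum_nonneg fun k _ => Set.indicator_nonneg (fun y _ => h0 y) _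
  -- All exceedances lie in the trimmed positions and contribute `0` to the truncated sum; each
  -- other trimmed position contributes at most `ℓ`.
  have hup : ∑ k ∈ Finset.univ.filter (fun k : Fin n => ¬ b ≤ (k : ℕ)), truncate χ ℓ (z k)
      ≤ (b - ∑ k : Fin n, {y | ℓ < χ y}.indicator (fun _ => (1 : ℝ)) (z k)) * ℓ := by
    have h1 : ∑ k ∈ Finset.univ.filter (fun k : Fin n => ¬ b ≤ (k : ℕ)), truncate χ ℓ (z k)
        ≤ ∑ k ∈ Finset.univ.filter (fun k : Fin n => ¬ b ≤ (k : ℕ)),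
            (ℓ - {y | ℓ < χ y}.indicator (fun _ => (1 : ℝ)) (z k) * ℓ) := by
      refine Finset.sum_le_sum fun k _ => ?_
      by_cases hk : χ (z k) ≤ ℓ
      · have h2 : z k ∉ {y | ℓ < χ y} := not_lt.2 hk
        rw [truncate, Set.indicator_of_mem (s := {x | χ x ≤ ℓ}) hk, Set.indicator_of_notMem h2]
        linarith
      · have h2 : z k ∈ {y | ℓ < χ y} := not_le.1 hk
        rw [truncate, Set.indicator_of_notMem (s := {x | χ x ≤ ℓ}) hk, Set.indicator_of_mem h2]
        linarith
    have h3 : ∑ k ∈ Finset.univ.filter (fun k : Fin n => ¬ b ≤ (k : ℕ)), {y | ℓ < χ y}.indicator (fun _ => (1 : ℝ)) (z k)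
        = ∑ k : Fin n, {y | ℓ < χ y}.indicator (fun _ => (1 : ℝ)) (z k) := by
      refine Finset.sum_filter_of_ne fun k _ hk => ?_
      intro hbk
      have h2 : z k ∉ {y | ℓ < χ y} := not_lt.2 (hsmall k hbk)
      exact hk (Set.indicator_of_notMem h2 _)
    have h4 : ((Finset.univ.filter fun k : Fin n => ¬ b ≤ (k : ℕ)).card : ℝ) ≤ b := by
      rw [Nat.cast_le]
      have h2 := Finset.card_le_card_of_injOn (s := Finset.univ.filter fun k : Fin n => ¬ b ≤ (k : ℕ))
        (t := Finset.range b) (fun k => (k : ℕ)) (fun k hk => by simpa using hk)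
        (fun i _ j _ h => Fin.ext h)
      rwa [Finset.card_range] at h2
    rw [Finset.sum_sub_distrib, Finset.sum_const, ← Finset.sum_mul, h3, nsmul_eq_mul] at h1
    refine h1.trans ?_
    rw [sub_mul]
    gcongr
  rw [htrim]
  change _ ≤ ∑ k : Fin n, truncate χ ℓ (z k) ∧ ∑ k : Fin n, truncate χ ℓ (z k) -
    (b - ∑ k : Fin n, {y | ℓ < χ y}.indicator (fun _ => (1 : ℝ)) (z k)) * ℓ ≤ _
  constructor <;> linarith

end Trimming

/-! ### Parameter choice, cells and their weights -/

section Estimates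

/-- Choice of the parameter in the Bernstein inequality for counts with mean about `i`. -/
theorem exists_bernstein_parameter {t₀ C : ℝ} (ht₀ : 0 < t₀) (hC : 0 < C) :
    ∃ W : ℝ, 4 ≤ W ∧ ∀ ε i Λ V : ℝ, 0 < ε → ε < 1 / 2 → 0 ≤ i → 1 ≤ Λ → V ≤ i + 2 →
      ∃ t : ℝ, 0 ≤ t ∧ t ≤ t₀ ∧
        -(t * (W * max (i ^ (1 / 2 + ε) * Λ ^ (1 / 2 - ε)) Λ / 2) / 2) + C * t ^ 2 * V
          ≤ -(4 * Λ) - 4 * i ^ (2 * ε) := by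
  -- The fraction makes `t₀ W / 4` at least `8 + 3 C t₀²`: the second term cancels the quadratic
  -- error, and `8D` covers `4Λ + 4 i ^ (2ε)`. The summand `4` ensures `W ≥ 4`. Nothing depends on
  -- `ε`.
  refine ⟨(32 + 12 * C * t₀ ^ 2) / t₀ + 4, le_add_of_nonneg_left (by positivity), ?_⟩
  set W := (32 + 12 * C * t₀ ^ 2) / t₀ + 4 with hW
  intro ε i Λ V hε hε' hi hΛ hV
  have hΛ0 : 0 < Λ := by linarith
  set R := max i Λ with hR
  have hRΛ : Λ ≤ R := le_max_right _ _
  have hRi : i ≤ R := le_max_left _ _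
  have hR0 : 0 < R := hΛ0.trans_le hRΛ
  have hVR : V ≤ 3 * R := by linarith
  set M := max (i ^ (1 / 2 + ε) * Λ ^ (1 / 2 - ε)) Λ with hM
  set D := R ^ (2 * ε) * Λ ^ (1 - 2 * ε) with hD
  have hMR : R ^ (1 / 2 + ε) * Λ ^ (1 / 2 - ε) ≤ M := by
    rcases le_total i Λ with h | h
    · rw [hR, max_eq_right h, ← Real.rpow_add hΛ0]
      norm_num
      exact le_max_right _ _
    · rw [hR, max_eq_left h]
      exact le_max_left _ _
  -- Chosen so that the linear gain `τ * M` is at least `D` while the quadratic cost `τ ^ 2 * R`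
  -- equals `D`.
  set τ := (Λ / R) ^ (1 / 2 - ε) with hτ
  have hτ0 : 0 < τ := by positivity
  have hτ1 : τ ≤ 1 :=
    Real.rpow_le_one (by positivity) ((div_le_one hR0).2 hRΛ) (by linarith)
  have hτΛ : τ = Λ ^ (1 / 2 - ε) / R ^ (1 / 2 - ε) := Real.div_rpow hΛ0.le hR0.le _
  have eΛ : Λ ^ (1 / 2 - ε) * Λ ^ (1 / 2 - ε) = Λ ^ (1 - 2 * ε) := by
    rw [← Real.rpow_add hΛ0]
    ring_nf
  have hτM : D ≤ τ * M := by
    have e : τ * (R ^ (1 / 2 + ε) * Λ ^ (1 / 2 - ε)) = D := by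
      have e1 : R ^ (1 / 2 + ε) = R ^ (2 * ε) * R ^ (1 / 2 - ε) := by
        rw [← Real.rpow_add hR0]
        ring_nf
      rw [hτΛ, e1, hD, ← eΛ]
      field_simp
    rw [← e]
    gcongr
  have hτR : τ ^ 2 * R = D := by
    have e1 : R = R ^ (2 * ε) * (R ^ (1 / 2 - ε) * R ^ (1 / 2 - ε)) := by
      rw [← Real.rpow_add hR0, ← Real.rpow_add hR0]
      ring_nf
      rw [Real.rpow_one]
    rw [hτΛ, hD, ← eΛ, div_pow, div_mul_eq_mul_div, div_eq_iff (by positivity)]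
    linear_combination (Λ ^ (1 / 2 - ε)) ^ 2 * e1
  have hDΛ : Λ ≤ D := by
    calc Λ = Λ ^ (2 * ε) * Λ ^ (1 - 2 * ε) := by
          rw [← Real.rpow_add hΛ0]
          ring_nf
          rw [Real.rpow_one]
      _ ≤ D := by rw [hD]; gcongr
  have hDi : i ^ (2 * ε) ≤ D := by
    calc i ^ (2 * ε) ≤ R ^ (2 * ε) * 1 := by rw [mul_one]; gcongr
      _ ≤ D := by
        have := Real.one_le_rpow hΛ (by linarith : 0 ≤ 1 - 2 * ε)
        rw [hD]
        gcongr
  have hD0 : 0 < D := hΛ0.trans_le hDΛ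
  refine ⟨t₀ * τ, by positivity, mul_le_of_le_one_right ht₀.le hτ1, ?_⟩
  have h1 : t₀ * W * D ≤ t₀ * τ * (W * M) := by
    calc t₀ * W * D ≤ t₀ * W * (τ * M) := by gcongr
      _ = _ := by ring
  have h2 : C * (t₀ * τ) ^ 2 * V ≤ 3 * C * t₀ ^ 2 * D := by
    calc C * (t₀ * τ) ^ 2 * V ≤ C * (t₀ * τ) ^ 2 * (3 * R) := by gcongr
      _ = 3 * C * t₀ ^ 2 * (τ ^ 2 * R) := by ring
      _ = _ := by rw [hτR]
  have h3 : t₀ * W = 32 + 12 * C * t₀ ^ 2 + 4 * t₀ := by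
    rw [hW]
    field_simp
  have h4 : 0 ≤ t₀ * D := by positivity
  rw [h3] at h1
  nlinarith

theorem summable_exp_neg_rpow {a s : ℝ} (ha : 0 < a) (hs : 0 < s) :
    Summable fun n : ℕ => Real.exp (-a * (n : ℝ) ^ s) := by
  have h1 : Tendsto (fun n : ℕ => (n : ℝ) ^ s) atTop atTop :=
    (tendsto_rpow_atTop hs).comp tendsto_natCast_atTop_atTop
  have h2 := ((isLittleO_exp_neg_mul_rpow_atTop ha (-2 / s)).comp_tendsto h1).isBigO
  refine summable_of_isBigO_nat (g := fun n : ℕ => (n : ℝ) ^ (-2 : ℝ))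
    (Real.summable_nat_rpow.2 (by norm_num)) (h2.congr_right fun n => ?_)
  simp only [Function.comp_apply]
  rw [← Real.rpow_mul (Nat.cast_nonneg n), mul_div_cancel₀ _ hs.ne']

/-- The weight of the cell `(k, i, j)`, see `countCell`. -/
noncomputable def cellWeight (ε : ℝ) (c : ℕ × ℕ × ℕ) : ℝ :=
  2 * Real.exp 2 * ((c.1 * Real.log 2) ^ 4)⁻¹ *
    (Real.exp (-2 * (c.2.1 : ℝ) ^ (2 * ε)) * Real.exp (-1 * (c.2.2 : ℝ) ^ (2 * ε)))

theorem summable_cellWeight {ε : ℝ} (hε : 0 < ε) : Summable (cellWeight ε) := by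
  have h1 : Summable fun k : ℕ => 2 * Real.exp 2 * (((k : ℝ) * Real.log 2) ^ 4)⁻¹ := by
    have : (fun k : ℕ => 2 * Real.exp 2 * (((k : ℝ) * Real.log 2) ^ 4)⁻¹)
        = fun k : ℕ => (2 * Real.exp 2 * (Real.log 2 ^ 4)⁻¹) * ((k : ℝ) ^ 4)⁻¹ := by
      funext k
      rw [mul_pow, mul_inv]
      ring
    rw [this]
    exact (Real.summable_nat_pow_inv.2 (by norm_num)).mul_left _
  have h2 := (summable_exp_neg_rpow (a := 2) two_pos (by positivity : 0 < 2 * ε)).mul_of_nonneg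
    (summable_exp_neg_rpow (a := 1) one_pos (by positivity : 0 < 2 * ε))
    (fun _ => (Real.exp_pos _).le) (fun _ => (Real.exp_pos _).le)
  exact h1.mul_of_nonneg h2 (fun k => by positivity) (fun c => by positivity)

/-- As `j ^ (2ε) ≤ 2 i ^ (2ε) + 2`, half of the decay in `i` can be traded for decay in `j`. This
turns the bound into a product weight, summable over all triples. -/
theorem two_mul_exp_le_cellWeight {ε : ℝ} (hε : 0 < ε) (hε' : ε < 1 / 2) {k i j : ℕ}
    (hk : 0 < k) (hj : j ≤ 2 * (i + 1)) :
    2 * Real.exp (-(4 * Real.log (k * Real.log 2)) - 4 * (i : ℝ) ^ (2 * ε))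
      ≤ cellWeight ε (k, i, j) := by
  have hpos : 0 < (k : ℝ) * Real.log 2 := by
    have := Real.log_pos (by norm_num : (1 : ℝ) < 2)
    positivity
  have h1 : Real.exp (-(4 * Real.log (k * Real.log 2))) = ((k * Real.log 2) ^ 4)⁻¹ := by
    rw [Real.exp_neg, show 4 * Real.log (k * Real.log 2)
      = ((4 : ℕ) : ℝ) * Real.log (k * Real.log 2) by norm_num, Real.exp_nat_mul,
      Real.exp_log hpos]
  have h2 : (j : ℝ) ^ (2 * ε) ≤ 2 * (i : ℝ) ^ (2 * ε) + 2 := by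
    calc (j : ℝ) ^ (2 * ε) ≤ (2 * ((i : ℝ) + 1)) ^ (2 * ε) := by
          refine Real.rpow_le_rpow (by positivity) ?_ (by positivity)
          exact_mod_cast hj
      _ = 2 ^ (2 * ε) * ((i : ℝ) + 1) ^ (2 * ε) := Real.mul_rpow (by positivity) (by positivity)
      _ ≤ 2 ^ (1 : ℝ) * ((i : ℝ) ^ (2 * ε) + 1 ^ (2 * ε)) := by
          gcongr
          · norm_num
          · linarith
          · exact Real.rpow_add_le_add_rpow (by positivity) (by positivity) (by positivity)
              (by linarith)
      _ = _ := by rw [Real.rpow_one, Real.one_rpow]; ring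
  rw [cellWeight, sub_eq_add_neg, Real.exp_add, h1]
  have h3 : Real.exp (-(4 * (i : ℝ) ^ (2 * ε))) ≤
      Real.exp 2 * (Real.exp (-2 * (i : ℝ) ^ (2 * ε)) * Real.exp (-1 * (j : ℝ) ^ (2 * ε))) := by
    rw [← Real.exp_add, ← Real.exp_add]
    exact Real.exp_le_exp.2 (by linarith)
  calc 2 * (((k * Real.log 2) ^ 4)⁻¹ * Real.exp (-(4 * (i : ℝ) ^ (2 * ε))))
      ≤ 2 * (((k * Real.log 2) ^ 4)⁻¹ * (Real.exp 2 *
        (Real.exp (-2 * (i : ℝ) ^ (2 * ε)) * Real.exp (-1 * (j : ℝ) ^ (2 * ε))))) := by gcongr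
    _ = _ := by ring

/-- In a cell, `n` lies between consecutive powers of two, `a` between consecutive integers, and
`n` varies by the relative amount `1 / (a + 1)`. -/
noncomputable def countCell (a : ℕ → ℝ) (n : ℕ) : ℕ × ℕ × ℕ :=
  (Nat.log 2 n, ⌊a n⌋₊, n * (⌊a n⌋₊ + 1) / 2 ^ Nat.log 2 n)

/-- Equal third coordinates give `|n - n'| (i + 1) ≤ 2 ^ k ≤ n'`, while `p n' ≤ (i + 1) / n'`. So
pairing a time of the cell with the level of another moves the mean by at most `1`. -/
theorem abs_mul_sub_le_of_countCell_eq {a p : ℕ → ℝ} (ha : ∀ n : ℕ, a n = n * p n)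
    (hp : ∀ n, 0 ≤ p n) {n n' : ℕ} (hn' : n' ≠ 0) (h : countCell a n = countCell a n') :
    |n * p n' - a n'| ≤ 1 := by
  simp only [countCell, Prod.mk.injEq] at h
  obtain ⟨h1, h2, h3⟩ := h
  rw [h1, h2] at h3
  set i := ⌊a n'⌋₊ with hi
  set q := 2 ^ Nat.log 2 n' with hq
  have hq0 : 0 < q := by positivity
  have hqn : q ≤ n' := Nat.pow_log_le_self 2 hn'
  have hq1 := Nat.div_add_mod (n * (i + 1)) q
  have hq2 := Nat.div_add_mod (n' * (i + 1)) q
  have hm1 := Nat.mod_lt (n * (i + 1)) hq0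
  have hm2 := Nat.mod_lt (n' * (i + 1)) hq0
  rw [h3] at hq1
  have hd : |(n : ℝ) - n'| * (i + 1) ≤ q := by
    rw [← abs_of_nonneg (by positivity : (0 : ℝ) ≤ i + 1), ← abs_mul, abs_le, sub_mul]
    have e1 : n * (i + 1) ≤ n' * (i + 1) + q := by omega
    have e2 : n' * (i + 1) ≤ n * (i + 1) + q := by omega
    have e1' : (n : ℝ) * (i + 1) ≤ n' * (i + 1) + q := by exact_mod_cast e1
    have e2' : (n' : ℝ) * (i + 1) ≤ n * (i + 1) + q := by exact_mod_cast e2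
    constructor <;> linarith
  have hn0 : (0 : ℝ) < n' := by exact_mod_cast Nat.pos_of_ne_zero hn'
  have hlt : n' * p n' ≤ i + 1 := by
    rw [← ha]
    exact (Nat.lt_floor_add_one _).le
  rw [ha, ← sub_mul, abs_mul, abs_of_nonneg (hp n')]
  have hqn' : (q : ℝ) ≤ n' := by exact_mod_cast hqn
  have : n' * (|(n : ℝ) - n'| * p n') ≤ n' * 1 :=
    calc n' * (|(n : ℝ) - n'| * p n') = |(n : ℝ) - n'| * (n' * p n') := by ring
      _ ≤ |(n : ℝ) - n'| * (i + 1) := by gcongr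
      _ ≤ n' * 1 := by linarith
  exact le_of_mul_le_mul_left this hn0

end Estimates

/-! ### Almost sure control of the number of exceedances -/

section Counts

variable {Ω : Type*} [MeasurableSpace Ω] {T : Ω → Ω} {μ : Measure Ω} [IsProbabilityMeasure μ]
  {χ : Ω → ℝ} {F : Type*} [NormedCommRing F] [NormedAlgebra ℂ F] [CompleteSpace F]
  {ι : F →ₗ[ℂ] (Ω →ₘ[μ] ℂ)}

/-- The number of `i < n` with `χ (T^i x) > ℓ`. -/
noncomputable def exceedances (T : Ω → Ω) (χ : Ω → ℝ) (n : ℕ) (ℓ : ℝ) (x : Ω) : ℝ :=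
  ∑ i ∈ Finset.range n, {y | ℓ < χ y}.indicator (fun _ => (1 : ℝ)) (T^[i] x)

theorem exceedances_le_exceedances {n n' : ℕ} (hn : n ≤ n') {ℓ ℓ' : ℝ} (hℓ : ℓ' ≤ ℓ) (x : Ω) :
    exceedances T χ n ℓ x ≤ exceedances T χ n' ℓ' x := by
  calc exceedances T χ n ℓ x ≤ exceedances T χ n ℓ' x :=
        Finset.sum_le_sum fun i _ => Set.indicator_le_indicator_of_subset
          (fun y hy => lt_of_le_of_lt hℓ hy) (fun _ => zero_le_one) _
    _ ≤ exceedances T χ n' ℓ' x := Finset.sum_le_sum_of_subset_of_nonneg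
        (Finset.range_mono hn) fun i _ _ => Set.indicator_nonneg (fun _ _ => zero_le_one) _

theorem aSeq_nonneg (f : ℕ → ℝ) (n : ℕ) : 0 ≤ aSeq μ χ f n :=
  mul_nonneg (Nat.cast_nonneg n) (sub_nonneg.2 (cdf_le_one _ _))

/-- The number of exceedances of `f n` deviates from its mean `a n` by at most a multiple of
`max (a ^ (1/2 + ε) * (log log n) ^ (1/2 - ε)) (log log n)`. -/
theorem PropertyD.exists_ae_eventually_abs_exceedances_sub_le (hD : PropertyD T μ ι χ) :
    ∃ W : ℝ, 0 < W ∧ ∀ (ε : ℝ) (f : ℕ → ℝ), 0 < ε → ε < 1 / 2 → (∀ n, 0 < f n) →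
      ∀ᵐ x ∂μ, ∀ᶠ n : ℕ in atTop, |exceedances T χ n (f n) x - aSeq μ χ f n| ≤
        W * max (aSeq μ χ f n ^ (1 / 2 + ε) * Real.log (Real.log n) ^ (1 / 2 - ε))
          (Real.log (Real.log n)) := by
  obtain ⟨K, hK, hKb⟩ := hD.norm_indicator_le
  obtain ⟨t₀, C, ht₀, hC, hB⟩ := hD.propertyC.exists_bernstein hK
  obtain ⟨W, hW4, hW⟩ := exists_bernstein_parameter ht₀ hC
  refine ⟨W, by linarith, ?_⟩
  intro ε f hε hε' hf
  set a := aSeq μ χ f with ha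
  set p : ℕ → ℝ := fun n => 1 - distFun μ χ (f n) with hp
  have hap : ∀ n : ℕ, a n = n * p n := fun n => rfl
  have hp0 : ∀ n, 0 ≤ p n := fun n => sub_nonneg.2 (cdf_le_one _ _)
  have ha0 : ∀ n, 0 ≤ a n := aSeq_nonneg f
  set M : ℕ → ℝ := fun n => max (a n ^ (1 / 2 + ε) * Real.log (Real.log n) ^ (1 / 2 - ε))
    (Real.log (Real.log n)) with hM
  have hlog2 : 0 < Real.log 2 := Real.log_pos (by norm_num)
  obtain ⟨k₀, hk₀⟩ : ∃ k₀ : ℕ, ∀ k ≥ k₀, 1 ≤ Real.log (k * Real.log 2) := by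
    have : Tendsto (fun k : ℕ => Real.log (k * Real.log 2)) atTop atTop :=
      Real.tendsto_log_atTop.comp (tendsto_natCast_atTop_atTop.atTop_mul_const hlog2)
    exact eventually_atTop.1 (this.eventually_ge_atTop 1)
  have hMlow : ∀ n : ℕ, k₀ ≤ Nat.log 2 n → n ≠ 0 → 0 < Nat.log 2 n →
      max ((⌊a n⌋₊ : ℝ) ^ (1 / 2 + ε) * Real.log (Nat.log 2 n * Real.log 2) ^ (1 / 2 - ε))
        (Real.log (Nat.log 2 n * Real.log 2)) ≤ M n := by
    intro n hn hn0 hk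
    have h1 : Real.log (Nat.log 2 n * Real.log 2) ≤ Real.log (Real.log n) := by
      refine Real.log_le_log (by positivity) ?_
      rw [← Real.log_pow]
      refine Real.log_le_log (by positivity) ?_
      exact_mod_cast Nat.pow_log_le_self 2 hn0
    have h2 := hk₀ _ hn
    have h3 := Nat.floor_le (ha0 n)
    exact max_le_max (mul_le_mul (Real.rpow_le_rpow (Nat.cast_nonneg _) h3 (by linarith))
      (Real.rpow_le_rpow (by linarith) h1 (by linarith))
      (Real.rpow_nonneg (by linarith) _) (Real.rpow_nonneg (ha0 n) _)) h1
  -- One event per cell. Requiring `0 < Nat.log 2 n` empties the cells with `k = 0`, whose weight is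
  -- `0` because the inverse of `0` is `0`.
  let E : ℕ × ℕ × ℕ → Set Ω := fun c =>
    {x | ∃ n : ℕ, k₀ ≤ Nat.log 2 n ∧ 0 < Nat.log 2 n ∧ countCell a n = c ∧
      W * M n < |exceedances T χ n (f n) x - a n|}
  have hE : ∀ c, μ.real (E c) ≤ cellWeight ε c := by
    rintro ⟨k, i, j⟩
    have hw0 : 0 ≤ cellWeight ε (k, i, j) := by
      rw [cellWeight]
      positivity
    set A : Set ℕ := {n | k₀ ≤ Nat.log 2 n ∧ 0 < Nat.log 2 n ∧ countCell a n = (k, i, j)} with hA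
    rcases A.eq_empty_or_nonempty with hAe | hAne
    · have : E (k, i, j) = ∅ := by
        refine Set.eq_empty_of_forall_notMem fun x hx => ?_
        obtain ⟨n, h1, h2, h3, _⟩ := hx
        have : n ∈ A := ⟨h1, h2, h3⟩
        rw [hAe] at this
        exact this
      rw [this, measureReal_empty]
      exact hw0
    have hAprop : ∀ n ∈ A, n ≠ 0 ∧ Nat.log 2 n = k ∧ ⌊a n⌋₊ = i := by
      rintro n ⟨_, h2, h3⟩
      simp only [countCell, Prod.mk.injEq] at h3
      refine ⟨?_, h3.1, h3.2.1⟩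
      rintro rfl
      simp at h2
    have hAfin : A.Finite := by
      refine (Set.finite_Iio (2 ^ (k + 1))).subset fun n hn => ?_
      obtain ⟨h0, h1, _⟩ := hAprop n hn
      rw [← h1]
      exact Nat.lt_pow_succ_log_self (by norm_num) n
    have hfac : k₀ ≤ k ∧ 0 < k ∧ j ≤ 2 * (i + 1) := by
      obtain ⟨n, hn⟩ := hAne
      obtain ⟨h0, h1, h2⟩ := hAprop n hn
      obtain ⟨h3, h4, h5⟩ := hn
      refine ⟨h1 ▸ h3, h1 ▸ h4, ?_⟩
      simp only [countCell, Prod.mk.injEq] at h5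
      rw [← h5.2.2, h5.2.1]
      refine Nat.div_le_of_le_mul ?_
      have := (Nat.lt_pow_succ_log_self (b := 2) (by norm_num) n).le
      calc n * (i + 1) ≤ 2 ^ (Nat.log 2 n + 1) * (i + 1) := Nat.mul_le_mul_right _ this
        _ = _ := by ring
    obtain ⟨hk₀k, hk0, hj⟩ := hfac
    -- Times and levels are extremised separately: the extreme pairs `(n₁, f m₂)` and `(n₂, f m₁)`
    -- need not come from a single index.
    obtain ⟨n₁, hn₁, hn₁max⟩ := A.exists_max_image (fun n => n) hAfin hAne
    obtain ⟨n₂, hn₂, hn₂min⟩ := A.exists_min_image (fun n => n) hAfin hAne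
    obtain ⟨m₁, hm₁, hm₁max⟩ := A.exists_max_image f hAfin hAne
    obtain ⟨m₂, hm₂, hm₂min⟩ := A.exists_min_image f hAfin hAne
    set Λ := Real.log (k * Real.log 2) with hΛ
    have hΛ1 : 1 ≤ Λ := hk₀ k hk₀k
    set m := max ((i : ℝ) ^ (1 / 2 + ε) * Λ ^ (1 / 2 - ε)) Λ with hm
    have hm1 : 1 ≤ m := hΛ1.trans (le_max_right _ _)
    have hMm : ∀ n ∈ A, m ≤ M n := by
      intro n hn
      obtain ⟨h0, h1, h2⟩ := hAprop n hn
      have := hMlow n hn.1 h0 hn.2.1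
      rwa [h1, h2] at this
    have hmean : ∀ n ∈ A, ∀ n' ∈ A, |n * p n' - a n'| ≤ 1 := fun n hn n' hn' =>
      abs_mul_sub_le_of_countCell_eq hap hp0 (hAprop n' hn').1 (hn.2.2.trans hn'.2.2.symm)
    have haA : ∀ n ∈ A, (i : ℝ) ≤ a n ∧ a n ≤ i + 1 := by
      intro n hn
      rw [← (hAprop n hn).2.2]
      exact ⟨Nat.floor_le (ha0 n), (Nat.lt_floor_add_one _).le⟩
    have htail : ∀ n ∈ A, ∀ n' ∈ A,
        μ.real {x | n * p n' + W * m / 2 ≤ exceedances T χ n (f n') x}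
          ≤ Real.exp (-(4 * Λ) - 4 * (i : ℝ) ^ (2 * ε)) ∧
        μ.real {x | exceedances T χ n (f n') x ≤ n * p n' - W * m / 2}
          ≤ Real.exp (-(4 * Λ) - 4 * (i : ℝ) ^ (2 * ε)) := by
      intro n hn n' hn'
      obtain ⟨t, ht, htt₀, hexp⟩ := hW ε i Λ (n * p n') hε hε' (Nat.cast_nonneg i) hΛ1 (by
        have h1 := (abs_le.1 (hmean n hn n' hn')).2
        have h2 := (haA n' hn').2
        linarith)
      obtain ⟨g, hg, hgK⟩ := hKb (f n') (hf n')
      have hb := hB (fun x => {y | f n' < χ y}.indicator (fun _ => (1 : ℝ)) x) g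
        (measurable_const.indicator (measurableSet_lt measurable_const hD.measurable))
        (fun x => Set.indicator_nonneg (fun _ _ => zero_le_one) x)
        (fun x => Set.indicator_le' (fun _ _ => le_rfl) (fun _ _ => zero_le_one) x)
        (by
          filter_upwards [hg] with x hx
          rw [hx]
          simp only [Set.indicator_apply]
          split_ifs <;> simp)
        hgK t ht htt₀ n (W * m / 2) (by positivity)
      rw [integral_indicator_lt hD.measurable] at hb
      exact ⟨hb.1.trans (Real.exp_le_exp.2 hexp), hb.2.trans (Real.exp_le_exp.2 hexp)⟩
    -- Within a cell, `a n` and the means of the extreme counts differ by at most `2`, and `W * m /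
    -- 2 ≥ 2` absorbs this. Half of the deviation is left for the tail bound.
    have hsub : E (k, i, j) ⊆ {x | n₁ * p m₂ + W * m / 2 ≤ exceedances T χ n₁ (f m₂) x} ∪
        {x | exceedances T χ n₂ (f m₁) x ≤ n₂ * p m₁ - W * m / 2} := by
      rintro x ⟨n, h1, h2, h3, h4⟩
      have hn : n ∈ A := ⟨h1, h2, h3⟩
      have h5 : W * m ≤ W * M n := mul_le_mul_of_nonneg_left (hMm n hn) (by linarith)
      have h6 : 4 ≤ W * m := by nlinarith
      have h7 := haA n hn
      rcases lt_abs.1 h4 with h | h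
      · left
        have e1 := exceedances_le_exceedances (T := T) (χ := χ) (hn₁max n hn) (hm₂min n hn) x
        have e2 := (abs_le.1 (hmean n₁ hn₁ m₂ hm₂)).2
        have e3 := haA m₂ hm₂
        change n₁ * p m₂ + W * m / 2 ≤ exceedances T χ n₁ (f m₂) x
        linarith
      · right
        have e1 := exceedances_le_exceedances (T := T) (χ := χ) (hn₂min n hn) (hm₁max n hn) x
        have e2 := (abs_le.1 (hmean n₂ hn₂ m₁ hm₁)).1
        have e3 := haA m₁ hm₁
        change exceedances T χ n₂ (f m₁) x ≤ n₂ * p m₁ - W * m / 2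
        linarith
    calc μ.real (E (k, i, j)) ≤ _ := measureReal_mono hsub
      _ ≤ _ := measureReal_union_le _ _
      _ ≤ _ := add_le_add (htail n₁ hn₁ m₂ hm₂).1 (htail n₂ hn₂ m₁ hm₁).2
      _ = 2 * Real.exp (-(4 * Λ) - 4 * (i : ℝ) ^ (2 * ε)) := by ring
      _ ≤ _ := two_mul_exp_le_cellWeight hε hε' hk0 hj
  filter_upwards [ae_finite_setOf_mem_of_summable (μ := μ) (summable_cellWeight hε)
    (Eventually.of_forall hE)] with x hx
  -- Only finitely many cells are bad, hence finitely many dyadic blocks, so every larger `n` is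
  -- good.
  obtain ⟨k₁, hk₁⟩ : ∃ k₁, ∀ c, x ∈ E c → c.1 ≤ k₁ := by
    obtain ⟨k₁, hk₁⟩ := (hx.image Prod.fst).bddAbove
    exact ⟨k₁, fun c hc => hk₁ (Set.mem_image_of_mem _ hc)⟩
  filter_upwards [eventually_ge_atTop (2 ^ (k₀ + k₁ + 1))] with n hn
  by_contra! hbad
  have hlog : k₀ + k₁ + 1 ≤ Nat.log 2 n := Nat.le_log_of_pow_le (by norm_num) hn
  have := hk₁ (countCell a n) ⟨n, by omega, by omega, rfl, hbad⟩
  simp only [countCell] at this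
  omega

end Counts

/-! ### Conclusion: squeezing the trimmed sum -/

theorem theorem1p2 {Ω : Type*} [MeasurableSpace Ω] (T : Ω → Ω) (μ : Measure Ω)
    [IsProbabilityMeasure μ]
    {F : Type*} [NormedCommRing F] [NormedAlgebra ℂ F] [CompleteSpace F]
    (ι : F →ₗ[ℂ] (Ω →ₘ[μ] ℂ)) (χ : Ω → ℝ) (hD : PropertyD T μ ι χ) :
    ∃ W : ℝ, 0 < W ∧
      ∀ (ε : ℝ) (f : ℕ → ℝ), 0 < ε → ε < 1 / 4 →
        (∀ n, 0 < f n) → Tendsto f atTop atTop →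
        (∀ᶠ n in atTop, 0 < dSeq μ χ f n) →
        Tendsto (fun n : ℕ => f n / dSeq μ χ f n *
          max (aSeq μ χ f n ^ (1 / 2 + ε) * Real.log (Real.log n) ^ (1 / 2 - ε))
            (Real.log n)) atTop (𝓝 0) →
        ∀ b : ℕ → ℕ,
          (∀ n : ℕ, b n = ⌈aSeq μ χ f n +
            W * max (aSeq μ χ f n ^ (1 / 2 + ε) * Real.log (Real.log n) ^ (1 / 2 - ε))
              (Real.log (Real.log n))⌉₊) →
          ∀ᵐ x ∂μ, Tendsto (fun n : ℕ => trimmedSum T χ n (b n) x / dSeq μ χ f n)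
            atTop (𝓝 1) := by
  obtain ⟨W, hW, hcount⟩ := hD.exists_ae_eventually_abs_exceedances_sub_le (T := T)
  refine ⟨W, hW, ?_⟩
  intro ε f hε hε' hf hfinf hd hlim b hb
  set a := aSeq μ χ f with ha
  set d := dSeq μ χ f with hd'
  set M : ℕ → ℝ := fun n => a n ^ (1 / 2 + ε) * Real.log (Real.log n) ^ (1 / 2 - ε) with hM
  have hlogn : ∀ᶠ n : ℕ in atTop, 1 ≤ Real.log n :=
    (Real.tendsto_log_atTop.comp tendsto_natCast_atTop_atTop).eventually_ge_atTop 1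
  have hlimlog : Tendsto (fun n : ℕ => f n / d n * Real.log n) atTop (𝓝 0) := by
    refine squeeze_zero' ?_ ?_ hlim
    · filter_upwards [hd, hlogn] with n h1 h2
      have := hf n
      positivity
    · filter_upwards [hd] with n h1
      have := hf n
      exact mul_le_mul_of_nonneg_left (le_max_right _ _) (by positivity)
  filter_upwards [hcount ε f hε (by linarith) hf, hD.ae_tendsto_truncatedSum_div hf hd hlimlog]
    with x hx hS
  have hlow : Tendsto (fun n : ℕ =>
      (∑ i ∈ Finset.range n, truncate χ (f n) (T^[i] x)) / d n
        - (2 * W + 1) * (f n / d n * max (M n) (Real.log n))) atTop (𝓝 1) := by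
    have := hS.sub (hlim.const_mul (2 * W + 1))
    rwa [mul_zero, sub_zero] at this
  -- The surplus `b n` minus the count collects `W` from the definition of `b n`, `W` from the
  -- deviation of the count, and at most `1` from rounding up; the last is absorbed since the
  -- maximum is at least `log n ≥ 1`.
  have hbounds : ∀ᶠ n : ℕ in atTop,
      trimmedSum T χ n (b n) x ≤ ∑ i ∈ Finset.range n, truncate χ (f n) (T^[i] x) ∧
      ∑ i ∈ Finset.range n, truncate χ (f n) (T^[i] x)
        - (2 * W + 1) * max (M n) (Real.log n) * f n ≤ trimmedSum T χ n (b n) x := by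
    filter_upwards [hx, hlogn] with n hn hln
    have hM' : max (M n) (Real.log (Real.log n)) ≤ max (M n) (Real.log n) :=
      max_le_max le_rfl (Real.log_le_self (by linarith))
    have hM0 : 0 ≤ max (M n) (Real.log (Real.log n)) :=
      (Real.log_nonneg hln).trans (le_max_right _ _)
    have h1 : 1 ≤ max (M n) (Real.log n) := hln.trans (le_max_right _ _)
    obtain ⟨hn1, hn2⟩ := abs_le.1 hn
    have hble : a n + W * max (M n) (Real.log (Real.log n)) ≤ b n := by
      rw [hb n]
      exact Nat.le_ceil _
    have hblt : (b n : ℝ) < a n + W * max (M n) (Real.log (Real.log n)) + 1 := by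
      rw [hb n]
      exact Nat.ceil_lt_add_one (add_nonneg (aSeq_nonneg f n) (by positivity))
    have hN : exceedances T χ n (f n) x ≤ b n := by linarith
    obtain ⟨h2, h3⟩ := trimmedSum_mem_Icc T χ hD.nonneg (hf n).le hN
    refine ⟨h2, le_trans (sub_le_sub_left ?_ _) h3⟩
    refine mul_le_mul_of_nonneg_right ?_ (hf n).le
    change (b n : ℝ) - exceedances T χ n (f n) x ≤ _
    have h4 := mul_le_mul_of_nonneg_left hM' hW.le
    linarith
  refine tendsto_of_tendsto_of_tendsto_of_le_of_le' hlow hS ?_ ?_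
  · filter_upwards [hbounds, hd] with n hn hdn
    rw [le_div_iff₀ hdn, sub_mul, div_mul_cancel₀ _ hdn.ne']
    refine le_trans (le_of_eq ?_) hn.2
    field_simp
  · filter_upwards [hbounds, hd] with n hn hdn
    exact div_le_div_of_nonneg_right hn.1 hdn.le
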